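/- Let $1<p<q<5$ and consider the one-dimensional nonlinear Schrödinger equation $$ i\partial_t u+\partial_x^2u-|u|^{p-1}u+|u|^{q-1}u=0,\qquad (t,x)\in\mathbb R\times\mathbb R. $$ For every $\omega>0$ there is a positive function $\phi_\omega\in H^1(\mathbb R)\cap C^2(\mathbb R)$ such that $e^{i\omega t}\phi_\omega(x)$ is a solution. For any choice of such $\phi_\omega$, $\omega>0$, the function $M(\omega)=\frac12\|\phi_\omega\|_{L^2}^2$ is differentiable on $(0,\infty)$, and its derivative $M'(\omega)=\frac12\frac{d}{d\omega}\|\phi_\omega\|_{L^2}^2$ satisfies $$ \lim_{\omega\downarrow0}M'(\omega)=\begin{cases}-\infty, & p\ge\frac73,\\[4pt] c_{p,q}\,\dfrac{\Gamma\left(\frac{7-3p}{2(q-p)}\right)}{\Gamma\left(\frac{7-2p-q}{2(q-p)}\right)}, & p<\frac73,\end{cases} $$ where $$ c_{p,q}=\frac{\sqrt{2\pi}}{4}\left(\frac{q+1}{p+1}\right)^{\frac{7-3p}{2(q-p)}}\frac{(p+1)^{3/2}}{q-p}>0 $$ and $1/\Gamma(0)$ is read as $0$ (this occurs exactly when $2p+q=7$).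 -/

import Mathlib

open MeasureTheory Filter Topology

namespace DoublePowerNLS

/-- `u (t, x)` is a classical solution, on all of `ℝ × ℝ`, of
`i ∂ₜ u + ∂ₓ² u - |u|^(p-1) u + |u|^(q-1) u = 0`. -/
def IsClassicalSolution (p q : ℝ) (u : ℝ → ℝ → ℂ) : Prop :=
  (∀ x : ℝ, Differentiable ℝ (fun t : ℝ => u t x)) ∧
  (∀ t : ℝ, ContDiff ℝ 2 (u t)) ∧
  ∀ t x : ℝ,
    Complex.I * deriv (fun τ : ℝ => u τ x) t + iteratedDeriv 2 (u t) x
      - ((‖u t x‖ ^ (p - 1) : ℝ) : ℂ) * u t x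
      + ((‖u t x‖ ^ (q - 1) : ℝ) : ℂ) * u t x = 0

/-- `φ` is the profile of a standing wave of frequency `ω`: a positive function in `H¹(ℝ)` such that
`e^{iωt} φ(x)` solves the equation. For `ω > 0` it is unique up to translation. -/
structure IsStandingWaveProfile (p q ω : ℝ) (φ : ℝ → ℝ) : Prop where
  pos : ∀ x, 0 < φ x
  memLp : MemLp φ 2 volume
  memLp_deriv : MemLp (deriv φ) 2 volume
  solves : IsClassicalSolution p q
    (fun t x => Complex.exp (Complex.I * (ω : ℂ) * (t : ℂ)) * (φ x : ℂ))

/-- `M(ω) = ½ ‖φ_ω‖²_{L²}` for a family `ω ↦ φ_ω` of real functions. -/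
noncomputable def mass (φ : ℝ → ℝ → ℝ) (ω : ℝ) : ℝ :=
  1 / 2 * ∫ x : ℝ, φ ω x ^ 2

/-- The constant `c_{p,q}`. -/
noncomputable def limitConst (p q : ℝ) : ℝ :=
  Real.sqrt (2 * Real.pi) / 4 * ((q + 1) / (p + 1)) ^ ((7 - 3 * p) / (2 * (q - p))) *
    ((p + 1) ^ (3 / 2 : ℝ) / (q - p))

end DoublePowerNLS

namespace DoublePowerNLS

open Set

section MassIntegral

/-! ### The Euler beta integral over the reals -/

/-! A positive profile solves `φ'' = ω φ + φ^p - φ^q`. Since it lies in `H¹`, its energy constant is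
zero: `φ'² = φ² (ω + 2/(p+1) φ^(p-1) - 2/(q+1) φ^(q-1))`. Let `C` be the maximum of `φ^(q-p)`, write
`C = (q+1)/(p+1) · (1+e)`, and put `V = φ^(q-p) / C`. Then `ω = 2/(p+1) · C^((p-1)/(q-p)) · e`, and
the bracket is a constant times `w(V) = e (1 - V^k) + V^(k-1) (1 - V)` with `k = (q-1)/(q-p)`
(`first_integral_eq_weight`). Taking `V` as variable on each side of the unique maximum
(`exists_unique_max`) gives `M = const · C^β · J(e)`, where `J(e) = ∫₀¹ v^(m-1) w^(-1/2) dv`, `m =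
2/(q-p)`, `β = (5-p)/(2(q-p))` (`half_integral_sq`). The formula holds for every profile, so
uniqueness up to translation is not needed.

The map `e ↦ ω` is an increasing bijection of `(0,∞)` with positive derivative, so `M'(ω) = (dM/de)
/ (dω/de)`, and `ω ↓ 0` means `e ↓ 0`. There `w` tends to `v^(k-1) (1-v)` and `J(e)` to `B(β, 1/2)`.
In contrast, `J'(e) = -½ ∫ v^(m-1) (1-v^k) w^(-3/2)` has a limiting integrand of order `v^(α-1)` at
`0`, with `α = (7-3p)/(2(q-p))`.

If `p ≥ 7/3`, then `α ≤ 0`, the integral diverges at least logarithmically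
(`log_le_massIntegralDeriv`), and `M' → -∞`. If `p < 7/3`, integration by parts gives `J'(0⁺) = -β
B(β, 1/2) + (α - 1/2) B(α, 1/2)` (`massIntegralDeriv_zero`). The `B(β, 1/2)` term cancels against
the derivative of `C^β`, and the rest is `(α - 1/2) B(α, 1/2) = √π Γ(α) / Γ(α - 1/2)`.

Existence comes from the same first integral: with `V = cosh(y)^(-2)`, the square-root singularity
at the maximum disappears and a scalar autonomous equation for `y` remains
(`exists_isProfileSolution`). -/

theorem integrableOn_beta {α β : ℝ} (hα : 0 < α) (hβ : 0 < β) :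
    IntegrableOn (fun v : ℝ => v ^ (α - 1) * (1 - v) ^ (β - 1)) (Ioo 0 1) := by
  have h := Complex.betaIntegral_convergent (u := α) (v := β) (by simpa) (by simpa)
  rw [intervalIntegrable_iff_integrableOn_Ioo_of_le zero_le_one] at h
  refine IntegrableOn.congr_fun h.re (fun x hx => ?_) measurableSet_Ioo
  have h1 : (0 : ℝ) ≤ 1 - x := by linarith [hx.2]
  simp only [RCLike.re_to_complex]
  rw [← Complex.ofReal_one, ← Complex.ofReal_sub, ← Complex.ofReal_sub, ← Complex.ofReal_sub,
    ← Complex.ofReal_cpow hx.1.le, ← Complex.ofReal_cpow h1, ← Complex.ofReal_mul,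
    Complex.ofReal_re]

theorem integral_beta {α β : ℝ} (hα : 0 < α) (hβ : 0 < β) :
    ∫ v in Ioo (0 : ℝ) 1, v ^ (α - 1) * (1 - v) ^ (β - 1) = ProbabilityTheory.beta α β := by
  have h := Complex.betaIntegral_convergent (u := α) (v := β) (by simpa) (by simpa)
  rw [intervalIntegrable_iff_integrableOn_Ioo_of_le zero_le_one] at h
  rw [ProbabilityTheory.beta_eq_betaIntegralReal α β hα hβ, Complex.betaIntegral,
    intervalIntegral.integral_of_le zero_le_one, integral_Ioc_eq_integral_Ioo,
    ← RCLike.re_to_complex, ← integral_re h]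
  refine setIntegral_congr_fun measurableSet_Ioo (fun x hx => ?_)
  have h1 : (0 : ℝ) ≤ 1 - x := by linarith [hx.2]
  simp only [RCLike.re_to_complex]
  rw [← Complex.ofReal_one, ← Complex.ofReal_sub, ← Complex.ofReal_sub, ← Complex.ofReal_sub,
    ← Complex.ofReal_cpow hx.1.le, ← Complex.ofReal_cpow h1, ← Complex.ofReal_mul,
    Complex.ofReal_re]

/-- The integration by parts below produces `B(α + k, 1/2)`, and `α + k = β + 1`; this recurrence
brings it back to `B(β, 1/2)`, which is `J(0)`. -/
theorem beta_add_one_half {β : ℝ} (hβ : 0 < β) :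
    (β + 1 / 2) * ProbabilityTheory.beta (β + 1) (1 / 2) =
      β * ProbabilityTheory.beta β (1 / 2) := by
  have h1 : Real.Gamma (β + 1 + 1 / 2) = (β + 1 / 2) * Real.Gamma (β + 1 / 2) := by
    rw [← Real.Gamma_add_one (by positivity)]; ring_nf
  have h2 : Real.Gamma (β + 1 / 2) ≠ 0 := (Real.Gamma_pos_of_pos (by positivity)).ne'
  rw [ProbabilityTheory.beta, ProbabilityTheory.beta, h1, Real.Gamma_add_one hβ.ne']
  field_simp

/-- The functional equation at `α - 1/2`. At `α = 1/2` both sides vanish because `Real.Gamma 0 = 0`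
and division by zero gives zero, which realises the convention `1/Γ(0) = 0`. -/
theorem sub_half_mul_beta_half (α : ℝ) :
    (α - 1 / 2) * ProbabilityTheory.beta α (1 / 2) =
      √Real.pi * (Real.Gamma α / Real.Gamma (α - 1 / 2)) := by
  rw [ProbabilityTheory.beta, Real.Gamma_one_half_eq]
  rcases eq_or_ne (α - 1 / 2) 0 with h | h
  · rw [h]; simp
  · have h1 : Real.Gamma (α + 1 / 2) = (α - 1 / 2) * Real.Gamma (α - 1 / 2) := by
      rw [← Real.Gamma_add_one h]; ring_nf
    rw [h1, mul_comm (Real.Gamma α), mul_div_assoc, ← mul_assoc, mul_comm (α - 1 / 2),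
      mul_assoc, mul_div_assoc', mul_div_mul_left _ _ h]

/-! ### The weight and the mass integral -/

/-- The normalised squared logarithmic derivative of a profile, as a function of a power `v` of the
profile; `e` measures the distance of the maximum of the profile from its limit at frequency zero. -/
noncomputable def weight (k e v : ℝ) : ℝ := e * (1 - v ^ k) + v ^ (k - 1) * (1 - v)

/-- The mass of a profile, up to an explicit factor. -/
noncomputable def massIntegral (k m e : ℝ) : ℝ :=
  ∫ v in Ioo (0 : ℝ) 1, v ^ (m - 1) * weight k e v ^ (-1 / 2 : ℝ)

/-- The derivative of `massIntegral`, up to the factor `-1/2`. -/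
noncomputable def massIntegralDeriv (k m e : ℝ) : ℝ :=
  ∫ v in Ioo (0 : ℝ) 1, v ^ (m - 1) * ((1 - v ^ k) * weight k e v ^ (-3 / 2 : ℝ))

section weight

variable {k v : ℝ}

theorem one_sub_le_one_sub_rpow (hk : 1 < k) (hv : v ∈ Ioo (0 : ℝ) 1) : 1 - v ≤ 1 - v ^ k := by
  have := Real.rpow_le_rpow_of_exponent_ge hv.1 hv.2.le hk.le
  rw [Real.rpow_one] at this
  linarith

theorem one_sub_rpow_pos (hk : 1 < k) (hv : v ∈ Ioo (0 : ℝ) 1) : 0 < 1 - v ^ k := by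
  linarith [one_sub_le_one_sub_rpow hk hv, hv.2]

theorem one_sub_rpow_le (hk : 1 < k) (hv : v ∈ Ioo (0 : ℝ) 1) : 1 - v ^ k ≤ k * (1 - v) := by
  have := one_add_mul_self_le_rpow_one_add (s := v - 1) (by linarith [hv.1]) hk.le
  rw [add_sub_cancel] at this
  linarith

theorem weight_zero_pos (hv : v ∈ Ioo (0 : ℝ) 1) : 0 < weight k 0 v := by
  have := Real.rpow_pos_of_pos hv.1 (k - 1)
  have h2 : 0 < 1 - v := by linarith [hv.2]
  simp only [weight, zero_mul, zero_add]
  positivity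

theorem weight_mono (hk : 1 < k) (hv : v ∈ Ioo (0 : ℝ) 1) : Monotone (fun e => weight k e v) := by
  intro a b hab
  simp only [weight]
  gcongr
  exact (one_sub_rpow_pos hk hv).le

theorem weight_pos {e : ℝ} (hk : 1 < k) (he : 0 ≤ e) (hv : v ∈ Ioo (0 : ℝ) 1) :
    0 < weight k e v :=
  (weight_zero_pos hv).trans_le (weight_mono hk hv he)

theorem mul_le_weight {e : ℝ} (hv : v ∈ Ioo (0 : ℝ) 1) : e * (1 - v ^ k) ≤ weight k e v := by
  have := weight_zero_pos (k := k) hv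
  simp only [weight, zero_mul, zero_add] at this ⊢
  linarith

theorem weight_zero_rpow (s : ℝ) (hv : v ∈ Ioo (0 : ℝ) 1) :
    weight k 0 v ^ s = v ^ ((k - 1) * s) * (1 - v) ^ s := by
  have h2 : 0 ≤ 1 - v := by linarith [hv.2]
  rw [weight, zero_mul, zero_add, Real.mul_rpow (Real.rpow_nonneg hv.1.le _) h2,
    ← Real.rpow_mul hv.1.le]

theorem measurable_weight (k e : ℝ) : Measurable (weight k e) := by
  unfold weight; fun_prop

theorem rpow_mul_weight_zero {m : ℝ} (hv : v ∈ Ioo (0 : ℝ) 1) :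
    v ^ (m - 1) * weight k 0 v ^ (-1 / 2 : ℝ) =
      v ^ (m - (k - 1) / 2 - 1) * (1 - v) ^ (1 / 2 - 1 : ℝ) := by
  rw [weight_zero_rpow _ hv, ← mul_assoc, ← Real.rpow_add hv.1]
  ring_nf

end weight

variable {k m : ℝ}

/-! ### Convergence of the mass integral as `e ↓ 0` -/

theorem integrableOn_massIntegral_zero (hβ : 0 < m - (k - 1) / 2) :
    IntegrableOn (fun v : ℝ => v ^ (m - 1) * weight k 0 v ^ (-1 / 2 : ℝ)) (Ioo 0 1) :=
  (integrableOn_beta hβ one_half_pos).congr_fun (fun _ hv => (rpow_mul_weight_zero hv).symm)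
    measurableSet_Ioo

theorem massIntegral_zero (hβ : 0 < m - (k - 1) / 2) :
    massIntegral k m 0 = ProbabilityTheory.beta (m - (k - 1) / 2) (1 / 2) := by
  rw [← integral_beta hβ one_half_pos]
  exact setIntegral_congr_fun measurableSet_Ioo (fun _ hv => rpow_mul_weight_zero hv)

theorem weight_rpow_anti (hk : 1 < k) {a b s v : ℝ} (hv : v ∈ Ioo (0 : ℝ) 1) (ha : 0 ≤ a)
    (hab : a ≤ b) (hs : s ≤ 0) : weight k b v ^ s ≤ weight k a v ^ s :=
  Real.rpow_le_rpow_of_nonpos (weight_pos hk ha hv) (weight_mono hk hv hab) hs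

theorem norm_massIntegrand_le (hk : 1 < k) {e v : ℝ} (he : 0 ≤ e) (hv : v ∈ Ioo (0 : ℝ) 1) :
    ‖v ^ (m - 1) * weight k e v ^ (-1 / 2 : ℝ)‖ ≤
      v ^ (m - 1) * weight k 0 v ^ (-1 / 2 : ℝ) := by
  have h1 := Real.rpow_pos_of_pos hv.1 (m - 1)
  have h2 := Real.rpow_pos_of_pos (weight_pos hk he hv) (-1 / 2)
  rw [Real.norm_of_nonneg (by positivity)]
  exact mul_le_mul_of_nonneg_left (weight_rpow_anti hk hv le_rfl he (by norm_num)) h1.le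

theorem integrableOn_massIntegrand (hk : 1 < k) (hβ : 0 < m - (k - 1) / 2) {e : ℝ} (he : 0 ≤ e) :
    IntegrableOn (fun v : ℝ => v ^ (m - 1) * weight k e v ^ (-1 / 2 : ℝ)) (Ioo 0 1) := by
  refine Integrable.mono' (integrableOn_massIntegral_zero hβ) ?_ ?_
  · have := measurable_weight k e
    exact Measurable.aestronglyMeasurable (by fun_prop)
  · exact ae_restrict_of_forall_mem measurableSet_Ioo fun v hv => norm_massIntegrand_le hk he hv

theorem tendsto_massIntegral (hk : 1 < k) (hβ : 0 < m - (k - 1) / 2) :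
    Tendsto (massIntegral k m) (𝓝[>] 0) (𝓝 (massIntegral k m 0)) := by
  refine tendsto_integral_filter_of_dominated_convergence
    (fun v => v ^ (m - 1) * weight k 0 v ^ (-1 / 2 : ℝ)) ?_ ?_
    (integrableOn_massIntegral_zero hβ) ?_
  · refine Eventually.of_forall fun e => ?_
    have := measurable_weight k e
    exact Measurable.aestronglyMeasurable (by fun_prop)
  · filter_upwards [self_mem_nhdsWithin] with e he
    exact ae_restrict_of_forall_mem measurableSet_Ioo fun v hv =>
      norm_massIntegrand_le hk (le_of_lt he) hv
  · refine ae_restrict_of_forall_mem measurableSet_Ioo fun v hv => ?_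
    refine Tendsto.mono_left (ContinuousAt.tendsto ?_) nhdsWithin_le_nhds
    refine ContinuousAt.mul continuousAt_const (ContinuousAt.rpow_const ?_
      (Or.inl (weight_zero_pos hv).ne'))
    unfold weight
    fun_prop

/-! ### Differentiation of the mass integral at `e > 0` -/

theorem mul_rpow_neg_three_halves {w : ℝ} (hw : 0 < w) :
    w ^ (-3 / 2 : ℝ) * w = w ^ (-1 / 2 : ℝ) := by
  rw [← Real.rpow_add_one hw.ne']
  norm_num

theorem massIntegrandDeriv_nonneg (hk : 1 < k) {e v : ℝ} (he : 0 ≤ e) (hv : v ∈ Ioo (0 : ℝ) 1) :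
    0 ≤ v ^ (m - 1) * ((1 - v ^ k) * weight k e v ^ (-3 / 2 : ℝ)) := by
  have h1 := Real.rpow_pos_of_pos hv.1 (m - 1)
  have h2 := Real.rpow_pos_of_pos (weight_pos hk he hv) (-3 / 2)
  have h3 := one_sub_rpow_pos hk hv
  positivity

/-- Since `weight ≥ e (1 - v^k)`, the factor `1 - v^k` absorbs one power of the weight at the cost
of `a⁻¹`. The power `-3/2` becomes `-1/2`, so away from `e = 0` the condition `β > 0` suffices for
domination. -/
theorem massIntegrandDeriv_le (hk : 1 < k) {a e v : ℝ} (ha : 0 < a) (hae : a ≤ e)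
    (hv : v ∈ Ioo (0 : ℝ) 1) :
    v ^ (m - 1) * ((1 - v ^ k) * weight k e v ^ (-3 / 2 : ℝ)) ≤
      a⁻¹ * (v ^ (m - 1) * weight k 0 v ^ (-1 / 2 : ℝ)) := by
  have he : 0 < e := ha.trans_le hae
  have h1 := Real.rpow_pos_of_pos hv.1 (m - 1)
  have hw := weight_pos hk he.le hv
  have h2 := Real.rpow_pos_of_pos hw (-3 / 2)
  have h3 := one_sub_rpow_pos hk hv
  have h4 : 1 - v ^ k ≤ a⁻¹ * weight k e v := by
    rw [inv_mul_eq_div, le_div_iff₀ ha]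
    have := mul_le_weight (k := k) (e := e) hv
    nlinarith
  have h5 := weight_rpow_anti hk hv le_rfl he.le (s := -1 / 2) (by norm_num)
  calc v ^ (m - 1) * ((1 - v ^ k) * weight k e v ^ (-3 / 2 : ℝ))
      ≤ v ^ (m - 1) * ((a⁻¹ * weight k e v) * weight k e v ^ (-3 / 2 : ℝ)) := by gcongr
    _ = a⁻¹ * (v ^ (m - 1) * weight k e v ^ (-1 / 2 : ℝ)) := by
        rw [← mul_rpow_neg_three_halves hw]; ring
    _ ≤ _ := by gcongr

theorem hasDerivAt_massIntegral (hk : 1 < k) (hβ : 0 < m - (k - 1) / 2) {e : ℝ} (he : 0 < e) :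
    HasDerivAt (massIntegral k m) (-1 / 2 * massIntegralDeriv k m e) e := by
  have key := hasDerivAt_integral_of_dominated_loc_of_deriv_le (μ := volume.restrict (Ioo (0:ℝ) 1))
    (F := fun e v => v ^ (m - 1) * weight k e v ^ (-1 / 2 : ℝ)) (x₀ := e) (s := Ioi (e / 2))
    (F' := fun e v => -1 / 2 * (v ^ (m - 1) * ((1 - v ^ k) * weight k e v ^ (-3 / 2 : ℝ))))
    (bound := fun v => (e / 2)⁻¹ * (v ^ (m - 1) * weight k 0 v ^ (-1 / 2 : ℝ)))
    (Ioi_mem_nhds (by linarith)) ?_ (integrableOn_massIntegrand hk hβ he.le) ?_ ?_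
    ((integrableOn_massIntegral_zero hβ).const_mul _) ?_
  · have := key.2
    rw [integral_const_mul] at this
    exact this
  · refine Eventually.of_forall fun e => ?_
    have := measurable_weight k e
    exact Measurable.aestronglyMeasurable (by fun_prop)
  · have := measurable_weight k e
    exact Measurable.aestronglyMeasurable (by fun_prop)
  · refine ae_restrict_of_forall_mem measurableSet_Ioo fun v hv x hx => ?_
    have hx' : e / 2 ≤ x := le_of_lt hx
    have h0 := massIntegrandDeriv_nonneg (m := m) hk (e := x) (by linarith) hv
    rw [norm_mul, Real.norm_of_nonneg h0]
    have := massIntegrandDeriv_le (m := m) hk (half_pos he) hx' hv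
    rw [show ‖(-1 / 2 : ℝ)‖ = 1 / 2 by norm_num]
    linarith
  · refine ae_restrict_of_forall_mem measurableSet_Ioo fun v hv x hx => ?_
    have hx' : e / 2 < x := hx
    have hw := weight_pos hk (e := x) (by linarith) hv
    have h1 : HasDerivAt (fun e => weight k e v) (1 - v ^ k) x := by
      unfold weight
      simpa using ((hasDerivAt_id x).mul_const (1 - v ^ k)).add_const (v ^ (k - 1) * (1 - v))
    have h2 := (h1.rpow_const (p := -1 / 2) (Or.inl hw.ne')).const_mul (v ^ (m - 1))
    refine h2.congr_deriv ?_
    rw [show (-1 / 2 - 1 : ℝ) = -3 / 2 by norm_num]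
    ring

/-! ### The derivative of the mass integral as `e ↓ 0` -/

theorem rpow_mul_weightDeriv_zero {v : ℝ} (hv : v ∈ Ioo (0 : ℝ) 1) :
    v ^ (m - 1) * ((1 - v ^ k) * weight k 0 v ^ (-3 / 2 : ℝ)) =
      v ^ (m - 3 * (k - 1) / 2 - 1) * ((1 - v ^ k) * (1 - v) ^ (-3 / 2 : ℝ)) := by
  have : m - 3 * (k - 1) / 2 - 1 = m - 1 + (k - 1) * (-3 / 2) := by ring
  rw [weight_zero_rpow _ hv, this, Real.rpow_add hv.1]
  ring

/-- Bernoulli's inequality `1 - v^k ≤ k (1 - v)` tames the singularity at `v = 1`, leaving a beta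
integrand whose only remaining requirement is `α > 0` at `v = 0`. -/
theorem massIntegrandDeriv_zero_le (hk : 1 < k) {v : ℝ} (hv : v ∈ Ioo (0 : ℝ) 1) :
    v ^ (m - 1) * ((1 - v ^ k) * weight k 0 v ^ (-3 / 2 : ℝ)) ≤
      k * (v ^ (m - 3 * (k - 1) / 2 - 1) * (1 - v) ^ (1 / 2 - 1 : ℝ)) := by
  have h0 : 0 < 1 - v := by linarith [hv.2]
  have h1 := Real.rpow_pos_of_pos hv.1 (m - 3 * (k - 1) / 2 - 1)
  have h2 := Real.rpow_pos_of_pos h0 (-3 / 2)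
  rw [rpow_mul_weightDeriv_zero hv]
  calc _ ≤ v ^ (m - 3 * (k - 1) / 2 - 1) * ((k * (1 - v)) * (1 - v) ^ (-3 / 2 : ℝ)) := by
        gcongr
        exact one_sub_rpow_le hk hv
    _ = _ := by
        rw [show (1 / 2 - 1 : ℝ) = -1 / 2 by norm_num, ← mul_rpow_neg_three_halves h0]; ring

theorem integrableOn_massIntegrandDeriv_zero (hk : 1 < k) (hα : 0 < m - 3 * (k - 1) / 2) :
    IntegrableOn (fun v : ℝ => v ^ (m - 1) * ((1 - v ^ k) * weight k 0 v ^ (-3 / 2 : ℝ)))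
      (Ioo 0 1) := by
  refine Integrable.mono' ((integrableOn_beta hα one_half_pos).const_mul k) ?_ ?_
  · have := measurable_weight k 0
    exact Measurable.aestronglyMeasurable (by fun_prop)
  · refine ae_restrict_of_forall_mem measurableSet_Ioo fun v hv => ?_
    rw [Real.norm_of_nonneg (massIntegrandDeriv_nonneg hk le_rfl hv)]
    exact massIntegrandDeriv_zero_le hk hv

theorem tendsto_massIntegralDeriv (hk : 1 < k) (hα : 0 < m - 3 * (k - 1) / 2) :
    Tendsto (massIntegralDeriv k m) (𝓝[>] 0) (𝓝 (massIntegralDeriv k m 0)) := by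
  refine tendsto_integral_filter_of_dominated_convergence
    (fun v => v ^ (m - 1) * ((1 - v ^ k) * weight k 0 v ^ (-3 / 2 : ℝ))) ?_ ?_
    (integrableOn_massIntegrandDeriv_zero hk hα) ?_
  · refine Eventually.of_forall fun e => ?_
    have := measurable_weight k e
    exact Measurable.aestronglyMeasurable (by fun_prop)
  · filter_upwards [self_mem_nhdsWithin] with e he
    have he' : 0 ≤ e := le_of_lt he
    refine ae_restrict_of_forall_mem measurableSet_Ioo fun v hv => ?_
    rw [Real.norm_of_nonneg (massIntegrandDeriv_nonneg hk he' hv)]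
    have h1 := Real.rpow_pos_of_pos hv.1 (m - 1)
    have h3 := one_sub_rpow_pos hk hv
    exact mul_le_mul_of_nonneg_left (mul_le_mul_of_nonneg_left
      (weight_rpow_anti hk hv le_rfl he' (by norm_num)) h3.le) h1.le
  · refine ae_restrict_of_forall_mem measurableSet_Ioo fun v hv => ?_
    refine Tendsto.mono_left (ContinuousAt.tendsto ?_) nhdsWithin_le_nhds
    refine ContinuousAt.mul continuousAt_const (ContinuousAt.mul continuousAt_const
      (ContinuousAt.rpow_const ?_ (Or.inl (weight_zero_pos hv).ne')))
    unfold weight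
    fun_prop

theorem hasDerivAt_rpow_mul_one_sub_rpow (a : ℝ) {v : ℝ} (hv : v ∈ Ioo (0 : ℝ) 1) :
    HasDerivAt (fun v : ℝ => v ^ a * (1 - v) ^ (-1 / 2 : ℝ))
      (1 / 2 * (v ^ (a - 1) * (1 - v) ^ (-3 / 2 : ℝ)) +
        (a - 1 / 2) * (v ^ (a - 1) * (1 - v) ^ (1 / 2 - 1 : ℝ))) v := by
  have h0 : 0 < 1 - v := by linarith [hv.2]
  have h1 : HasDerivAt (fun v : ℝ => v ^ a) (a * v ^ (a - 1)) v :=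
    Real.hasDerivAt_rpow_const (Or.inl hv.1.ne')
  have h2 : HasDerivAt (fun v : ℝ => (1 - v) ^ (-1 / 2 : ℝ))
      (-1 * (-1 / 2) * (1 - v) ^ (-1 / 2 - 1 : ℝ)) v :=
    ((hasDerivAt_id v).const_sub 1).rpow_const (Or.inl h0.ne')
  refine (h1.mul h2).congr_deriv ?_
  have h3 : v ^ a = v ^ (a - 1) * v := by rw [← Real.rpow_add_one hv.1.ne', sub_add_cancel]
  rw [show (1 / 2 - 1 : ℝ) = -1 / 2 by norm_num, show (-1 / 2 - 1 : ℝ) = -3 / 2 by norm_num,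
    ← mul_rpow_neg_three_halves h0, h3]
  ring

/-- Integrate the derivative of `2 (v^α - v^(α+k)) (1-v)^(-1/2)`, whose boundary values are zero.
The two terms must stay together: separately, each has a nonintegrable `(1-v)^(-3/2)` at `v = 1`. -/
theorem integral_one_sub_rpow_mul {α : ℝ} (hk : 1 < k) (hα : 0 < α) :
    ∫ v in Ioo (0 : ℝ) 1, v ^ (α - 1) * ((1 - v ^ k) * (1 - v) ^ (-3 / 2 : ℝ)) =
      2 * ((α + k - 1 / 2) * ProbabilityTheory.beta (α + k) (1 / 2) -
        (α - 1 / 2) * ProbabilityTheory.beta α (1 / 2)) := by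
  have hαk : 0 < α + k := by linarith
  set f : ℝ → ℝ := fun v => v ^ (α - 1) * ((1 - v ^ k) * (1 - v) ^ (-3 / 2 : ℝ)) with hf
  set b : ℝ → ℝ → ℝ := fun a v => v ^ (a - 1) * (1 - v) ^ (1 / 2 - 1 : ℝ) with hb
  have fint : IntegrableOn f (Ioo 0 1) := by
    have := integrableOn_massIntegrandDeriv_zero (m := α + 3 * (k - 1) / 2) hk (by simpa)
    refine this.congr_fun (fun v hv => ?_) measurableSet_Ioo
    simp only [hf]
    rw [rpow_mul_weightDeriv_zero hv]
    simp
  have b1 : IntegrableOn (b α) (Ioo 0 1) := integrableOn_beta hα one_half_pos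
  have b2 : IntegrableOn (b (α + k)) (Ioo 0 1) := integrableOn_beta hαk one_half_pos
  have h2 := (b1.const_mul (2 * (α - 1 / 2))).sub (b2.const_mul (2 * (α + k - 1 / 2)))
  have h3 := fint.add h2
  have hder : ∀ v ∈ Ioo (0 : ℝ) 1, HasDerivAt
      (fun v : ℝ => 2 * (v ^ α * (1 - v) ^ (-1 / 2 : ℝ) - v ^ (α + k) * (1 - v) ^ (-1 / 2 : ℝ)))
      (f v + (2 * (α - 1 / 2) * b α v - 2 * (α + k - 1 / 2) * b (α + k) v)) v := by
    intro v hv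
    refine (((hasDerivAt_rpow_mul_one_sub_rpow α hv).sub
      (hasDerivAt_rpow_mul_one_sub_rpow (α + k) hv)).const_mul 2).congr_deriv ?_
    have : v ^ (α + k - 1) = v ^ (α - 1) * v ^ k := by rw [← Real.rpow_add hv.1]; ring_nf
    simp only [hf, hb]
    rw [this]
    ring
  have hint := intervalIntegral.integral_eq_sub_of_hasDerivAt_of_tendsto (fa := 0) (fb := 0)
    zero_lt_one hder ?_ ?_ ?_
  · rw [intervalIntegral.integral_of_le zero_le_one, integral_Ioc_eq_integral_Ioo] at hint
    have e1 := integral_add (μ := volume.restrict (Ioo (0:ℝ) 1)) fint h2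
    have e2 := integral_sub (μ := volume.restrict (Ioo (0:ℝ) 1))
      (b1.const_mul (2 * (α - 1 / 2))) (b2.const_mul (2 * (α + k - 1 / 2)))
    simp only [Pi.sub_apply] at e1
    rw [e2, integral_const_mul, integral_const_mul, integral_beta hα one_half_pos,
      integral_beta hαk one_half_pos, hint] at e1
    linarith
  · rw [intervalIntegrable_iff_integrableOn_Ioo_of_le zero_le_one]
    exact h3
  · have hc : ContinuousAt (fun v : ℝ => 2 * (v ^ α * (1 - v) ^ (-1 / 2 : ℝ) -
        v ^ (α + k) * (1 - v) ^ (-1 / 2 : ℝ))) 0 := by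
      have c1 : ContinuousAt (fun v : ℝ => (1 - v) ^ (-1 / 2 : ℝ)) 0 :=
        ContinuousAt.rpow_const (by fun_prop) (Or.inl (by norm_num))
      have c2 := Real.continuousAt_rpow_const 0 α (Or.inr hα.le)
      have c3 := Real.continuousAt_rpow_const 0 (α + k) (Or.inr hαk.le)
      exact ((c2.mul c1).sub (c3.mul c1)).const_mul 2
    have := hc.tendsto.mono_left (nhdsWithin_le_nhds (s := Ioi 0))
    simpa [Real.zero_rpow hα.ne', Real.zero_rpow hαk.ne'] using this
  · have hlim : Tendsto (fun v : ℝ => 2 * (k * (1 - v) ^ (1 / 2 : ℝ))) (𝓝[<] 1) (𝓝 0) := by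
      have c1 : ContinuousAt (fun v : ℝ => 2 * (k * (1 - v) ^ (1 / 2 : ℝ))) 1 :=
        ((ContinuousAt.rpow_const (by fun_prop) (Or.inr (by norm_num))).const_mul k).const_mul 2
      have := c1.tendsto.mono_left (nhdsWithin_le_nhds (s := Iio 1))
      simpa [Real.zero_rpow] using this
    have hev : ∀ᶠ v : ℝ in 𝓝[<] 1, v ∈ Ioo (0 : ℝ) 1 := Ioo_mem_nhdsLT zero_lt_one
    refine tendsto_of_tendsto_of_tendsto_of_le_of_le' tendsto_const_nhds hlim ?_ ?_
    all_goals
      filter_upwards [hev] with v hv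
      have h0 : 0 < 1 - v := by linarith [hv.2]
      have q1 := Real.rpow_pos_of_pos hv.1 α
      have q2 := Real.rpow_pos_of_pos h0 (-1 / 2)
      have q3 := one_sub_rpow_pos hk hv
      have q4 : v ^ α * (1 - v) ^ (-1 / 2 : ℝ) - v ^ (α + k) * (1 - v) ^ (-1 / 2 : ℝ) =
          v ^ α * (1 - v ^ k) * (1 - v) ^ (-1 / 2 : ℝ) := by
        rw [Real.rpow_add hv.1]; ring
      rw [q4]
    · positivity
    · have q5 : v ^ α ≤ 1 := Real.rpow_le_one hv.1.le hv.2.le hα.le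
      have q6 : (1 - v) ^ (1 / 2 : ℝ) = (1 - v) * (1 - v) ^ (-1 / 2 : ℝ) := by
        rw [mul_comm, ← Real.rpow_add_one h0.ne']; norm_num
      have q7 : v ^ α * (1 - v ^ k) ≤ k * (1 - v) := by
        nlinarith [one_sub_rpow_le hk hv]
      calc 2 * (v ^ α * (1 - v ^ k) * (1 - v) ^ (-1 / 2 : ℝ))
          ≤ 2 * (k * (1 - v) * (1 - v) ^ (-1 / 2 : ℝ)) := by gcongr
        _ = _ := by rw [q6, mul_assoc k]

theorem massIntegralDeriv_zero (hk : 1 < k) (hα : 0 < m - 3 * (k - 1) / 2) :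
    massIntegralDeriv k m 0 = 2 * ((m - (k - 1) / 2) *
        ProbabilityTheory.beta (m - (k - 1) / 2) (1 / 2) -
      (m - 3 * (k - 1) / 2 - 1 / 2) * ProbabilityTheory.beta (m - 3 * (k - 1) / 2) (1 / 2)) := by
  have h := integral_one_sub_rpow_mul hk hα
  rw [massIntegralDeriv, setIntegral_congr_fun measurableSet_Ioo
    (fun v hv => rpow_mul_weightDeriv_zero hv), h, ← beta_add_one_half (by linarith)]
  ring_nf

/-- The logarithmic lower bound for the derivative of the mass integral. -/
theorem log_le_massIntegralDeriv (hk : 1 < k) (hβ : 0 < m - (k - 1) / 2)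
    (hα : m - 3 * (k - 1) / 2 ≤ 0) {e : ℝ} (he : 0 < e)
    (he' : e ^ (k - 1)⁻¹ < 1 / 2) :
    1 / 2 * 2 ^ (-3 / 2 : ℝ) * (Real.log (1 / 2) - (k - 1)⁻¹ * Real.log e) ≤
      massIntegralDeriv k m e := by
  have hk1 : 0 < k - 1 := by linarith
  -- The threshold beyond which `e ≤ v^(k-1)`. On `(d, 1/2]` the weight is at most `2 v^(k-1)` and
  -- `1 - v^k ≥ 1/2`, so the integrand dominates a multiple of `v^(α-1) ≥ v⁻¹`.
  set d := e ^ (k - 1)⁻¹ with hd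
  have hd0 : 0 < d := Real.rpow_pos_of_pos he _
  have hde : d ^ (k - 1) = e := by
    rw [hd, ← Real.rpow_mul he.le, inv_mul_cancel₀ hk1.ne', Real.rpow_one]
  have hsub : Ioc d (1 / 2) ⊆ Ioo 0 1 := fun v hv => ⟨hd0.trans hv.1, by linarith [hv.2]⟩
  have hint : IntegrableOn (fun v : ℝ => v ^ (m - 1) *
      ((1 - v ^ k) * weight k e v ^ (-3 / 2 : ℝ))) (Ioo 0 1) := by
    refine Integrable.mono' ((integrableOn_massIntegral_zero hβ).const_mul e⁻¹) ?_ ?_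
    · have := measurable_weight k e
      exact Measurable.aestronglyMeasurable (by fun_prop)
    · refine ae_restrict_of_forall_mem measurableSet_Ioo fun v hv => ?_
      rw [Real.norm_of_nonneg (massIntegrandDeriv_nonneg hk he.le hv)]
      exact massIntegrandDeriv_le hk he le_rfl hv
  have hinv : IntervalIntegrable (fun v : ℝ => 1 / 2 * 2 ^ (-3 / 2 : ℝ) * v⁻¹) volume d (1 / 2) :=
    (intervalIntegral.intervalIntegrable_inv (fun x hx => by
      rw [uIcc_of_le he'.le] at hx; exact (hd0.trans_le hx.1).ne') (by fun_prop)).const_mul _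
  calc _ = ∫ v in d..(1 / 2), 1 / 2 * 2 ^ (-3 / 2 : ℝ) * v⁻¹ := by
        rw [intervalIntegral.integral_const_mul, integral_inv_of_pos hd0 (by norm_num),
          Real.log_div (by norm_num) hd0.ne', hd, Real.log_rpow he]
    _ = ∫ v in Ioc d (1 / 2), 1 / 2 * 2 ^ (-3 / 2 : ℝ) * v⁻¹ :=
        intervalIntegral.integral_of_le he'.le
    _ ≤ ∫ v in Ioc d (1 / 2), v ^ (m - 1) * ((1 - v ^ k) * weight k e v ^ (-3 / 2 : ℝ)) := by
        refine setIntegral_mono_on ?_ (hint.mono_set hsub) measurableSet_Ioc fun v hv => ?_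
        · exact (intervalIntegrable_iff_integrableOn_Ioc_of_le he'.le).1 hinv
        · have hv' := hsub hv
          have q1 : e ≤ v ^ (k - 1) := by
            rw [← hde]; exact Real.rpow_le_rpow hd0.le hv.1.le hk1.le
          have q2 : 1 / 2 ≤ 1 - v ^ k := by linarith [one_sub_le_one_sub_rpow hk hv', hv.2]
          have q3 : weight k e v ≤ 2 * v ^ (k - 1) := by
            unfold weight
            have := Real.rpow_pos_of_pos hv'.1 k
            have := Real.rpow_pos_of_pos hv'.1 (k - 1)
            nlinarith [hv'.1]
          have q4 : 2 ^ (-3 / 2 : ℝ) * v ^ ((k - 1) * (-3 / 2)) ≤ weight k e v ^ (-3 / 2 : ℝ) := by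
            rw [Real.rpow_mul hv'.1.le, ← Real.mul_rpow (by norm_num)
              (Real.rpow_nonneg hv'.1.le _)]
            exact Real.rpow_le_rpow_of_nonpos (weight_pos hk he.le hv') q3 (by norm_num)
          have q5 : v⁻¹ ≤ v ^ (m - 1) * v ^ ((k - 1) * (-3 / 2)) := by
            rw [← Real.rpow_add hv'.1, ← Real.rpow_neg_one]
            exact Real.rpow_le_rpow_of_exponent_ge hv'.1 hv'.2.le (by linarith)
          have p1 := Real.rpow_pos_of_pos hv'.1 (m - 1)
          have p2 := Real.rpow_pos_of_pos hv'.1 ((k - 1) * (-3 / 2))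
          have p3 : (0 : ℝ) < 2 ^ (-3 / 2 : ℝ) := by positivity
          calc 1 / 2 * 2 ^ (-3 / 2 : ℝ) * v⁻¹
              ≤ 1 / 2 * 2 ^ (-3 / 2 : ℝ) * (v ^ (m - 1) * v ^ ((k - 1) * (-3 / 2))) := by gcongr
            _ = v ^ (m - 1) * (1 / 2 * (2 ^ (-3 / 2 : ℝ) * v ^ ((k - 1) * (-3 / 2)))) := by ring
            _ ≤ _ := by gcongr
    _ ≤ _ := by
        refine setIntegral_mono_set hint ?_ (LE.le.eventuallyLE hsub)
        exact ae_restrict_of_forall_mem measurableSet_Ioo fun v hv =>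
          massIntegrandDeriv_nonneg hk he.le hv

theorem tendsto_massIntegralDeriv_atTop (hk : 1 < k) (hβ : 0 < m - (k - 1) / 2)
    (hα : m - 3 * (k - 1) / 2 ≤ 0) :
    Tendsto (massIntegralDeriv k m) (𝓝[>] 0) atTop := by
  have hk1 : 0 < (k - 1)⁻¹ := inv_pos.2 (by linarith)
  have h1 : Tendsto (fun e : ℝ => 1 / 2 * 2 ^ (-3 / 2 : ℝ) *
      (Real.log (1 / 2) - (k - 1)⁻¹ * Real.log e)) (𝓝[>] 0) atTop := by
    refine Tendsto.const_mul_atTop (by positivity) ?_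
    simp only [sub_eq_add_neg]
    refine tendsto_atTop_add_const_left _ _ ?_
    exact tendsto_neg_atBot_atTop.comp (Real.tendsto_log_nhdsGT_zero.const_mul_atBot hk1)
  refine tendsto_atTop_mono' _ ?_ h1
  have h2 : Tendsto (fun e : ℝ => e ^ (k - 1)⁻¹) (𝓝[>] 0) (𝓝 0) := by
    have := (Real.continuousAt_rpow_const 0 (k - 1)⁻¹ (Or.inr hk1.le)).tendsto.mono_left
      (nhdsWithin_le_nhds (s := Ioi 0))
    rwa [Real.zero_rpow hk1.ne'] at this
  filter_upwards [self_mem_nhdsWithin, h2.eventually (gt_mem_nhds one_half_pos)] with e he he'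
  exact log_le_massIntegralDeriv hk hβ hα he he'

end MassIntegral

/-! ### Algebra of the first integral -/

/-- The power `a ^ (q - p)` of the maximum `a` of the profile with parameter `e`. -/
noncomputable def amplitude (p q e : ℝ) : ℝ := (q + 1) / (p + 1) * (1 + e)

/-- The frequency of the profile with parameter `e`. -/
noncomputable def frequency (p q e : ℝ) : ℝ :=
  2 / (p + 1) * amplitude p q e ^ ((p - 1) / (q - p)) * e

theorem amplitude_pos {p q e : ℝ} (hp : 1 < p) (hpq : p < q) (he : 0 < e) :
    0 < amplitude p q e := by
  unfold amplitude
  have : 0 < q + 1 := by linarith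
  have : 0 < p + 1 := by linarith
  positivity

theorem frequency_pos {p q e : ℝ} (hp : 1 < p) (hpq : p < q) (he : 0 < e) :
    0 < frequency p q e := by
  have := amplitude_pos hp hpq he
  have : 0 < p + 1 := by linarith
  unfold frequency
  positivity

theorem one_lt_exponent {p q : ℝ} (hp : 1 < p) (hpq : p < q) : 1 < (q - 1) / (q - p) := by
  rw [one_lt_div (by linarith)]; linarith

theorem exponent_sub_one {p q : ℝ} (hpq : p < q) :
    (q - 1) / (q - p) - 1 = (p - 1) / (q - p) := by
  have : q - p ≠ 0 := by linarith
  field_simp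
  ring

theorem rpow_eq_of_rpow_sub {p q s w : ℝ} (hpq : p < q) (hs : 0 < s) (h : s ^ (q - p) = w)
    (a : ℝ) : s ^ a = w ^ (a / (q - p)) := by
  have : q - p ≠ 0 := by linarith
  rw [← h, ← Real.rpow_mul hs.le]
  congr 1
  field_simp

/-- The parametrisation is chosen so that `2/(q+1) · C = 2/(p+1) · (1+e)`: a common power of `C`
factors out and the bracket has its zero at `v = 1`. -/
theorem first_integral_eq_weight {p q e s v : ℝ} (hp : 1 < p) (hpq : p < q) (he : 0 < e)
    (hs : 0 < s) (hv : 0 < v) (h : s ^ (q - p) = amplitude p q e * v) :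
    frequency p q e + 2 / (p + 1) * s ^ (p - 1) - 2 / (q + 1) * s ^ (q - 1) =
      2 / (p + 1) * amplitude p q e ^ ((p - 1) / (q - p)) * weight ((q - 1) / (q - p)) e v := by
  have hC := amplitude_pos hp hpq he
  have hk := exponent_sub_one hpq
  have h1 : (q - 1) / (q - p) = (p - 1) / (q - p) + 1 := by linarith
  rw [weight, rpow_eq_of_rpow_sub hpq hs h, rpow_eq_of_rpow_sub hpq hs h, hk, h1,
    Real.mul_rpow hC.le hv.le, Real.mul_rpow hC.le hv.le, Real.rpow_add_one hC.ne',
    Real.rpow_add_one hv.ne', frequency]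
  have h2 : p + 1 ≠ 0 := by linarith
  have h3 : q + 1 ≠ 0 := by linarith
  have h4 : 2 / (q + 1) * amplitude p q e = 2 / (p + 1) * (1 + e) := by
    unfold amplitude; field_simp
  linear_combination (-(amplitude p q e ^ ((p - 1) / (q - p))) *
    (v ^ ((p - 1) / (q - p)) * v)) * h4

/-- The second derivative of the profile is strictly negative at the maximal level, so the profile
cannot stay at that level on an interval. -/
theorem force_neg {p q e s : ℝ} (hp : 1 < p) (hpq : p < q) (he : 0 < e)
    (hs : 0 < s) (h : s ^ (q - p) = amplitude p q e) :
    frequency p q e * s + s ^ p - s ^ q < 0 := by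
  have hC := amplitude_pos hp hpq he
  have h1 : (q - 1) / (q - p) = (p - 1) / (q - p) + 1 := by linarith [exponent_sub_one hpq]
  have e1 : s ^ p = s ^ (p - 1) * s := by rw [← Real.rpow_add_one hs.ne', sub_add_cancel]
  have e2 : s ^ q = s ^ (q - 1) * s := by rw [← Real.rpow_add_one hs.ne', sub_add_cancel]
  rw [e1, e2, rpow_eq_of_rpow_sub hpq hs h, rpow_eq_of_rpow_sub hpq hs h, h1,
    Real.rpow_add_one hC.ne', frequency]
  have hP := Real.rpow_pos_of_pos hC ((p - 1) / (q - p))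
  have h2 : 0 < p + 1 := by linarith
  have h3 : 2 / (p + 1) * e + 1 - amplitude p q e < 0 := by
    have : 2 / (p + 1) * e + 1 - amplitude p q e = -(e * (q - 1) + (q - p)) / (p + 1) := by
      unfold amplitude; field_simp; ring
    rw [this]
    apply div_neg_of_neg_of_pos _ h2
    nlinarith
  have h4 := mul_neg_of_pos_of_neg (mul_pos hP hs) h3
  linarith

theorem weight_neg {k e v : ℝ} (hk : 1 < k) (he : 0 < e) (hv : 1 < v) : weight k e v < 0 := by
  have h1 : 1 < v ^ k := Real.one_lt_rpow hv (by linarith)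
  have h2 : 0 < v ^ (k - 1) := by positivity
  unfold weight
  nlinarith

/-! ### The profile equation -/

/-- A positive `H¹` solution of the profile equation, with derivative `ψ`. -/
structure IsProfileSolution (p q ω : ℝ) (φ ψ : ℝ → ℝ) : Prop where
  pos : ∀ x, 0 < φ x
  memLp : MemLp φ 2 volume
  memLp_deriv : MemLp ψ 2 volume
  hasDerivAt : ∀ x, HasDerivAt φ (ψ x) x
  hasDerivAt_deriv : ∀ x, HasDerivAt ψ (ω * φ x + φ x ^ p - φ x ^ q) x

theorem iteratedDeriv_two_ofReal {φ ψ : ℝ → ℝ} {f : ℝ} {x : ℝ} (h1 : ∀ x, HasDerivAt φ (ψ x) x)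
    (h2 : HasDerivAt ψ f x) (c : ℂ) : iteratedDeriv 2 (fun x => c * (φ x : ℂ)) x = c * (f : ℂ) := by
  have e1 : deriv (fun x => c * (φ x : ℂ)) = fun x => c * (ψ x : ℂ) :=
    funext fun x => ((h1 x).ofReal_comp.const_mul c).deriv
  rw [iteratedDeriv_succ, iteratedDeriv_one, e1]
  exact (h2.ofReal_comp.const_mul c).deriv

theorem hasDerivAt_phase (ω t : ℝ) (z : ℂ) :
    HasDerivAt (fun τ : ℝ => Complex.exp (Complex.I * (ω : ℂ) * (τ : ℂ)) * z)
      (Complex.I * ω * (Complex.exp (Complex.I * (ω : ℂ) * (t : ℂ)) * z)) t := by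
  have h1 : HasDerivAt (fun τ : ℝ => Complex.I * (ω : ℂ) * (τ : ℂ)) (Complex.I * ω) t := by
    simpa using (Complex.ofRealCLM.hasDerivAt (x := t)).const_mul (Complex.I * (ω : ℂ))
  refine (h1.cexp.mul_const z).congr_deriv ?_
  ring

theorem norm_phase_mul (ω t s : ℝ) (hs : 0 < s) :
    ‖Complex.exp (Complex.I * (ω : ℂ) * (t : ℂ)) * (s : ℂ)‖ = s := by
  have : Complex.I * (ω : ℂ) * (t : ℂ) = ((ω * t : ℝ) : ℂ) * Complex.I := by push_cast; ring
  rw [norm_mul, this, Complex.norm_exp_ofReal_mul_I, one_mul, Complex.norm_real,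
    Real.norm_of_nonneg hs.le]

theorem rpow_sub_one_mul_self {s : ℝ} (hs : 0 < s) (a : ℝ) : s ^ (a - 1) * s = s ^ a := by
  rw [← Real.rpow_add_one hs.ne', sub_add_cancel]

/-- At time `0` the phase is `1`, so the regularity of `φ` and its real equation are read off from
the real part of the solution there. -/
theorem IsStandingWaveProfile.isProfileSolution {p q ω : ℝ} {φ : ℝ → ℝ}
    (h : IsStandingWaveProfile p q ω φ) : IsProfileSolution p q ω φ (deriv φ) := by
  obtain ⟨-, h2, h3⟩ := h.solves
  have hC : ContDiff ℝ 2 φ := by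
    have := Complex.reCLM.contDiff.comp (h2 0)
    simpa [Function.comp_def] using! this
  have hd1 : ∀ x, HasDerivAt φ (deriv φ x) x := fun x =>
    (hC.differentiable (by norm_num) x).hasDerivAt
  have hd2 : ∀ x, HasDerivAt (deriv φ) (deriv (deriv φ) x) x := fun x =>
    (((contDiff_succ_iff_deriv (n := 1)).1 hC).2.2.differentiable (by norm_num) x).hasDerivAt
  refine ⟨h.pos, h.memLp, h.memLp_deriv, hd1, fun x => ?_⟩
  convert! hd2 x using 1
  have e := h3 0 x
  simp only at e
  rw [(hasDerivAt_phase ω 0 (φ x)).deriv, iteratedDeriv_two_ofReal hd1 (hd2 x),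
    norm_phase_mul ω 0 (φ x) (h.pos x)] at e
  have e' := congrArg Complex.re e
  have hI : Complex.I * (Complex.I * ω * (φ x : ℂ)) = ((-(ω * φ x) : ℝ) : ℂ) := by
    push_cast
    linear_combination (ω * (φ x : ℂ)) * Complex.I_mul_I
  simp only [Complex.ofReal_zero, mul_zero, Complex.exp_zero, one_mul, hI,
    ← Complex.ofReal_mul, ← Complex.ofReal_add, ← Complex.ofReal_sub, Complex.ofReal_re,
    Complex.zero_re, rpow_sub_one_mul_self (h.pos x)] at e'
  linarith

theorem IsProfileSolution.isStandingWaveProfile {p q ω : ℝ} {φ ψ : ℝ → ℝ}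
    (h : IsProfileSolution p q ω φ ψ) : IsStandingWaveProfile p q ω φ := by
  have hd : deriv φ = ψ := funext fun x => (h.hasDerivAt x).deriv
  have hφ : Continuous φ := continuous_iff_continuousAt.2 fun x => (h.hasDerivAt x).continuousAt
  have hC : ContDiff ℝ 2 φ := by
    refine (contDiff_succ_iff_deriv (n := 1)).2
      ⟨fun x => (h.hasDerivAt x).differentiableAt, by simp, ?_⟩
    rw [hd, contDiff_one_iff_deriv]
    refine ⟨fun x => (h.hasDerivAt_deriv x).differentiableAt, ?_⟩
    rw [funext fun x => (h.hasDerivAt_deriv x).deriv]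
    have hr : ∀ a : ℝ, Continuous fun x => φ x ^ a := fun a =>
      hφ.rpow_const fun x => Or.inl (h.pos x).ne'
    exact ((hφ.const_mul ω).add (hr p)).sub (hr q)
  refine ⟨h.pos, h.memLp, hd ▸ h.memLp_deriv, fun x t => ?_, fun t => ?_, fun t x => ?_⟩
  · exact (hasDerivAt_phase ω t (φ x)).differentiableAt
  · exact contDiff_const.mul (Complex.ofRealCLM.contDiff.comp hC)
  · simp only
    rw [(hasDerivAt_phase ω t (φ x)).deriv,
      iteratedDeriv_two_ofReal h.hasDerivAt (h.hasDerivAt_deriv x),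
      norm_phase_mul ω t (φ x) (h.pos x), ← rpow_sub_one_mul_self (h.pos x) p,
      ← rpow_sub_one_mul_self (h.pos x) q]
    push_cast
    linear_combination (Complex.exp (Complex.I * (ω : ℂ) * (t : ℂ)) * ω * (φ x : ℂ)) *
      Complex.I_mul_I

/-- Reflection symmetry lets every statement about `+∞` or a right half-line serve for the left as
well. -/
theorem IsProfileSolution.comp_neg {p q ω : ℝ} {φ ψ : ℝ → ℝ} (h : IsProfileSolution p q ω φ ψ) :
    IsProfileSolution p q ω (fun x => φ (-x)) (fun x => -ψ (-x)) where
  pos x := h.pos _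
  memLp := h.memLp.comp_measurePreserving (Measure.measurePreserving_neg volume)
  memLp_deriv := (h.memLp_deriv.comp_measurePreserving (Measure.measurePreserving_neg volume)).neg
  hasDerivAt x := 
    ((h.hasDerivAt (-x)).comp x (hasDerivAt_neg x)).congr_deriv (by simp)
  hasDerivAt_deriv x := 
    ((h.hasDerivAt_deriv (-x)).comp x (hasDerivAt_neg x)).neg.congr_deriv (by simp)

namespace IsProfileSolution

variable {p q ω : ℝ} {φ ψ : ℝ → ℝ}

theorem tendsto_atTop (h : IsProfileSolution p q ω φ ψ) : Tendsto φ atTop (𝓝 0) := by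
  have h1 : Tendsto (fun x => φ x ^ 2) atTop (𝓝 0) := by
    refine tendsto_zero_of_hasDerivAt_of_integrableOn_Ioi (a := 0) (f' := fun x => 2 * (φ x * ψ x))
      (fun x _ => ?_) ?_ h.memLp.integrable_sq.integrableOn
    · refine ((h.hasDerivAt x).pow 2).congr_deriv ?_
      simp; ring
    · exact ((h.memLp.integrable_mul h.memLp_deriv).const_mul 2).integrableOn
  have h2 := (Real.continuous_sqrt.tendsto 0).comp h1
  rw [Real.sqrt_zero] at h2
  exact h2.congr fun x => Real.sqrt_sq (h.pos x).le

theorem tendsto_atBot (h : IsProfileSolution p q ω φ ψ) : Tendsto φ atBot (𝓝 0) := by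
  have := h.comp_neg.tendsto_atTop.comp tendsto_neg_atBot_atTop
  simpa [Function.comp_def] using this

/-- The energy `ψ² - F(φ)` is conserved. As `φ → 0` at `+∞`, `ψ²` tends to the energy constant; an
integrable function can only tend to zero, so the constant is zero. -/
theorem first_integral (hp : 1 < p) (hpq : p < q) (h : IsProfileSolution p q ω φ ψ) (x : ℝ) :
    ψ x ^ 2 = φ x ^ 2 * (ω + 2 / (p + 1) * φ x ^ (p - 1) - 2 / (q + 1) * φ x ^ (q - 1)) := by
  have hp1 : p + 1 ≠ 0 := by linarith
  have hq1 : q + 1 ≠ 0 := by linarith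
  set F : ℝ → ℝ := fun s => ω * s ^ 2 + 2 / (p + 1) * s ^ (p + 1) - 2 / (q + 1) * s ^ (q + 1)
  have hF0 : F 0 = 0 := by simp [F, Real.zero_rpow hp1, Real.zero_rpow hq1]
  have hFc : ContinuousAt F 0 := by
    have c1 := Real.continuousAt_rpow_const 0 (p + 1) (Or.inr (by linarith))
    have c2 := Real.continuousAt_rpow_const 0 (q + 1) (Or.inr (by linarith))
    exact (((continuousAt_id.pow 2).const_mul ω).add (c1.const_mul _)).sub (c2.const_mul _)
  have hder : ∀ x, HasDerivAt (fun x => ψ x ^ 2 - F (φ x)) 0 x := by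
    intro x
    have d0 := h.hasDerivAt x
    have d1 := (d0.rpow_const (p := p + 1) (Or.inl (h.pos x).ne')).const_mul (2 / (p + 1))
    have d2 := (d0.rpow_const (p := q + 1) (Or.inl (h.pos x).ne')).const_mul (2 / (q + 1))
    refine (((h.hasDerivAt_deriv x).pow 2).sub
      ((((d0.pow 2).const_mul ω).add d1).sub d2)).congr_deriv ?_
    simp only [add_sub_cancel_right]
    field_simp
    push_cast
    ring
  have hconst : ∀ x, ψ x ^ 2 - F (φ x) = ψ 0 ^ 2 - F (φ 0) := fun x =>
    is_const_of_deriv_eq_zero (fun x => (hder x).differentiableAt) (fun x => (hder x).deriv) x 0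
  have hlim : Tendsto (fun x => ψ x ^ 2) atTop (𝓝 (ψ 0 ^ 2 - F (φ 0))) := by
    have h1 : Tendsto (fun x => F (φ x)) atTop (𝓝 0) := by
      have := hFc.tendsto.comp h.tendsto_atTop
      rwa [hF0] at this
    have h2 := h1.const_add (ψ 0 ^ 2 - F (φ 0))
    rw [add_zero] at h2
    exact h2.congr fun x => by rw [← hconst x]; ring
  have hint : IntegrableAtFilter (fun x => ψ x ^ 2) atTop :=
    h.memLp_deriv.integrable_sq.integrableAtFilter _
  have hzero := hint.eq_zero_of_tendsto (fun s hs => by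
    rcases mem_atTop_sets.1 hs with ⟨b, hb⟩
    rw [← top_le_iff, ← Real.volume_Ici (a := b)]
    exact measure_mono hb) hlim
  have := hconst x
  have e1 : φ x ^ (p + 1) = φ x ^ 2 * φ x ^ (p - 1) := by
    rw [← Real.rpow_natCast, ← Real.rpow_add (h.pos x)]; congr 1; push_cast; ring
  have e2 : φ x ^ (q + 1) = φ x ^ 2 * φ x ^ (q - 1) := by
    rw [← Real.rpow_natCast, ← Real.rpow_add (h.pos x)]; congr 1; push_cast; ring
  simp only [hzero, F, e1, e2] at this
  linarith

end IsProfileSolution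

/-! ### The mass as an integral over the values of the profile -/

/-- Change of variable `v = V x`. The equation keeps `V'` nonzero beyond `x₀`, so `V` is injective
there by Rolle and maps onto `(0,1)` by the intermediate value theorem. Only `|V'|` enters, so its
sign need not be determined. -/
theorem setIntegral_rpow_eq_massIntegral {V V' : ℝ → ℝ} {x₀ r c e k m : ℝ} (hk : 1 < k)
    (hr : 0 < r) (hc : 0 < c) (he : 0 < e) (hV : ∀ x, HasDerivAt V (V' x) x) (hpos : ∀ x, 0 < V x)
    (hx₀ : V x₀ = 1) (hlim : Tendsto V atTop (𝓝 0)) (hlt : ∀ x, x₀ < x → V x < 1)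
    (hode : ∀ x, V' x ^ 2 = (r * V x) ^ 2 * (c * weight k e (V x))) :
    ∫ x in Ioi x₀, V x ^ m = (r * √c)⁻¹ * massIntegral k m e := by
  have hcont : Continuous V := continuous_iff_continuousAt.2 fun x => (hV x).continuousAt
  have hmem : ∀ x ∈ Ioi x₀, V x ∈ Ioo (0 : ℝ) 1 := fun x hx => ⟨hpos x, hlt x hx⟩
  have hw : ∀ x ∈ Ioi x₀, 0 < weight k e (V x) := fun x hx => weight_pos hk he.le (hmem x hx)
  have hne : ∀ x ∈ Ioi x₀, V' x ≠ 0 := fun x hx h0 => by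
    have := hode x
    have h1 := hw x hx
    have h2 := hpos x
    rw [h0] at this
    have : 0 < (r * V x) ^ 2 * (c * weight k e (V x)) := by positivity
    linarith
  have hinj : ∀ x ∈ Ioi x₀, ∀ y ∈ Ioi x₀, x < y → V x ≠ V y := fun x hx y _ hxy h => by
    obtain ⟨z, hz, hz'⟩ := exists_hasDerivAt_eq_zero hxy hcont.continuousOn h fun z _ => hV z
    exact hne z (lt_trans hx hz.1) hz'
  have hInj : InjOn V (Ioi x₀) := fun x hx y hy h => by
    rcases lt_trichotomy x y with hxy | hxy | hxy
    · exact absurd h (hinj x hx y hy hxy)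
    · exact hxy
    · exact absurd h.symm (hinj y hy x hx hxy)
  have himg : V '' Ioi x₀ = Ioo 0 1 := by
    refine Subset.antisymm (image_subset_iff.2 hmem) fun s hs => ?_
    obtain ⟨y, hy, hys⟩ := ((eventually_gt_atTop x₀).and (hlim.eventually (gt_mem_nhds hs.1))).exists
    obtain ⟨z, hz, rfl⟩ := intermediate_value_Ioo' hy.le hcont.continuousOn ⟨hys, hx₀ ▸ hs.2⟩
    exact ⟨z, hz.1, rfl⟩
  have key := integral_image_eq_integral_abs_deriv_smul measurableSet_Ioi
    (fun x _ => (hV x).hasDerivWithinAt) hInj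
    (fun v => (r * √c)⁻¹ * (v ^ (m - 1) * weight k e v ^ (-1 / 2 : ℝ)))
  rw [himg, integral_const_mul] at key
  rw [massIntegral, key]
  refine setIntegral_congr_fun measurableSet_Ioi fun x hx => ?_
  have h1 := hw x hx
  have h2 := hpos x
  have h3 : |V' x| = r * V x * (√c * √(weight k e (V x))) := by
    rw [← Real.sqrt_sq_eq_abs, hode x, Real.sqrt_mul (by positivity), Real.sqrt_sq (by positivity),
      Real.sqrt_mul hc.le]
  have h4 : √(weight k e (V x)) * weight k e (V x) ^ (-1 / 2 : ℝ) = 1 := by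
    rw [Real.sqrt_eq_rpow, ← Real.rpow_add h1]; norm_num
  have h5 : V x ^ m = V x ^ (m - 1) * V x := by rw [← Real.rpow_add_one h2.ne', sub_add_cancel]
  have h6 : 0 < √c := Real.sqrt_pos.2 hc
  simp only [smul_eq_mul]
  symm
  calc |V' x| * ((r * √c)⁻¹ * (V x ^ (m - 1) * weight k e (V x) ^ (-1 / 2 : ℝ)))
      = V x ^ (m - 1) * V x * ((r * √c) * (r * √c)⁻¹) *
          (√(weight k e (V x)) * weight k e (V x) ^ (-1 / 2 : ℝ)) := by rw [h3]; ring
    _ = V x ^ m := by rw [h4, mul_inv_cancel₀ (by positivity), mul_one, mul_one, h5]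

/-- The minimum over `[a, b]` is attained at an endpoint or at an interior critical point, and in
either case its value is `A`. -/
theorem eq_of_deriv_eq_zero_of_forall_le {φ ψ : ℝ → ℝ} {A a b : ℝ}
    (hφ : ∀ x, HasDerivAt φ (ψ x) x) (hle : ∀ x, φ x ≤ A) (hcrit : ∀ x, ψ x = 0 → φ x = A)
    (ha : φ a = A) (hb : φ b = A) : ∀ x ∈ Icc a b, φ x = A := by
  intro x hx
  have hab : a ≤ b := hx.1.trans hx.2
  have hcont : ContinuousOn φ (Icc a b) := fun x _ => (hφ x).continuousAt.continuousWithinAt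
  obtain ⟨y, hy, hmin⟩ := isCompact_Icc.exists_isMinOn ⟨a, left_mem_Icc.2 hab⟩ hcont
  have hyA : φ y = A := by
    rcases eq_or_lt_of_le hy.1 with rfl | h1
    · exact ha
    rcases eq_or_lt_of_le hy.2 with rfl | h2
    · exact hb
    exact hcrit y ((hmin.isLocalMin (Icc_mem_nhds h1 h2)).hasDerivAt_eq_zero (hφ y))
  exact le_antisymm (hle x) (hyA ▸ hmin hx)

namespace IsProfileSolution

variable {p q e : ℝ} {φ ψ : ℝ → ℝ}

/-- Above the level `A` the first integral would make `ψ²` negative, and strictly below it makes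
`ψ²` positive; hence `φ ≤ A`, with critical points only at level `A`. A maximum exists by decay. Two
points at level `A` would force `φ = A` between them, contrary to `force_neg`. -/
theorem exists_unique_max (hp : 1 < p) (hpq : p < q) (he : 0 < e)
    (h : IsProfileSolution p q (frequency p q e) φ ψ) :
    ∃ x₀, φ x₀ ^ (q - p) = amplitude p q e ∧
      ∀ x, x ≠ x₀ → φ x ^ (q - p) < amplitude p q e := by
  have hk := one_lt_exponent hp hpq
  have hC := amplitude_pos hp hpq he
  have hr : 0 < q - p := by linarith
  have hp1 : 0 < p + 1 := by linarith
  have hc : 0 < 2 / (p + 1) * amplitude p q e ^ ((p - 1) / (q - p)) := by positivity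
  have hψ : ∀ x, ψ x ^ 2 = φ x ^ 2 * (2 / (p + 1) * amplitude p q e ^ ((p - 1) / (q - p)) *
      weight ((q - 1) / (q - p)) e (φ x ^ (q - p) / amplitude p q e)) := fun x => by
    have hv : 0 < φ x ^ (q - p) / amplitude p q e := div_pos (Real.rpow_pos_of_pos (h.pos x) _) hC
    rw [h.first_integral hp hpq, first_integral_eq_weight hp hpq he (h.pos x) hv
      (mul_div_cancel₀ _ hC.ne').symm]
  set A := amplitude p q e ^ (1 / (q - p)) with hA
  have hA0 : 0 < A := Real.rpow_pos_of_pos hC _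
  have hAr : A ^ (q - p) = amplitude p q e := by
    rw [hA, ← Real.rpow_mul hC.le, one_div_mul_cancel hr.ne', Real.rpow_one]
  have hle : ∀ x, φ x ≤ A := fun x => by
    by_contra! hlt
    have h1 : 1 < φ x ^ (q - p) / amplitude p q e := by
      rw [one_lt_div hC, ← hAr]; exact Real.rpow_lt_rpow hA0.le hlt hr
    have h2 := mul_neg_of_pos_of_neg hc (weight_neg hk he h1)
    have h3 := mul_neg_of_pos_of_neg (sq_pos_of_pos (h.pos x)) h2
    nlinarith [hψ x, sq_nonneg (ψ x)]
  have hcrit : ∀ x, ψ x = 0 → φ x = A := fun x hx => by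
    refine (hle x).antisymm ?_
    by_contra! hlt
    have h0 : 0 < φ x ^ (q - p) / amplitude p q e := div_pos (Real.rpow_pos_of_pos (h.pos x) _) hC
    have h1 : φ x ^ (q - p) / amplitude p q e < 1 := by
      rw [div_lt_one hC, ← hAr]; exact Real.rpow_lt_rpow (h.pos x).le hlt hr
    have h2 := mul_pos hc (weight_pos hk he.le ⟨h0, h1⟩)
    have h3 := mul_pos (sq_pos_of_pos (h.pos x)) h2
    rw [← hψ x, hx] at h3
    simp at h3
  have hcont : Continuous φ := continuous_iff_continuousAt.2 fun x => (h.hasDerivAt x).continuousAt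
  obtain ⟨x₀, hx₀⟩ := hcont.exists_forall_ge' 0 (by
    rw [cocompact_eq_atBot_atTop, eventually_sup]
    exact ⟨(h.tendsto_atBot.eventually (gt_mem_nhds (h.pos 0))).mono fun _ => le_of_lt,
      (h.tendsto_atTop.eventually (gt_mem_nhds (h.pos 0))).mono fun _ => le_of_lt⟩)
  have hx₀A : φ x₀ = A :=
    hcrit x₀ (IsLocalMax.hasDerivAt_eq_zero (Eventually.of_forall hx₀) (h.hasDerivAt x₀))
  have hnot : ∀ a b, a < b → φ a = A → φ b ≠ A := fun a b hab ha hb => by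
    have hconst := eq_of_deriv_eq_zero_of_forall_le h.hasDerivAt hle hcrit ha hb
    have hnhds : ∀ x ∈ Ioo a b, φ =ᶠ[𝓝 x] fun _ => A := fun x hx => by
      filter_upwards [Icc_mem_nhds hx.1 hx.2] with y hy using hconst y hy
    have hψ0 : ∀ x ∈ Ioo a b, ψ x = 0 := fun x hx =>
      (h.hasDerivAt x).unique ((hasDerivAt_const x A).congr_of_eventuallyEq (hnhds x hx))
    have hmid : (a + b) / 2 ∈ Ioo a b := ⟨by linarith, by linarith⟩
    have hψn : ψ =ᶠ[𝓝 ((a + b) / 2)] fun _ => 0 := by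
      filter_upwards [Ioo_mem_nhds hmid.1 hmid.2] with y hy using hψ0 y hy
    have h0 := (h.hasDerivAt_deriv _).unique
      ((hasDerivAt_const ((a + b) / 2) (0 : ℝ)).congr_of_eventuallyEq hψn)
    have := force_neg hp hpq he (h.pos ((a + b) / 2))
      (by rw [hconst _ (Ioo_subset_Icc_self hmid), hAr])
    linarith
  refine ⟨x₀, hx₀A ▸ hAr, fun x hx => ?_⟩
  rw [← hAr]
  refine Real.rpow_lt_rpow (h.pos x).le ((hle x).lt_of_ne fun hxA => ?_) hr
  rcases lt_or_gt_of_ne hx with hlt | hlt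
  · exact hnot x x₀ hlt hxA hx₀A
  · exact hnot x₀ x hlt hx₀A hxA

theorem setIntegral_sq (hp : 1 < p) (hpq : p < q) (he : 0 < e)
    (h : IsProfileSolution p q (frequency p q e) φ ψ) {x₀ : ℝ}
    (hx₀ : φ x₀ ^ (q - p) = amplitude p q e)
    (hlt : ∀ x, x₀ < x → φ x ^ (q - p) < amplitude p q e) :
    ∫ x in Ioi x₀, φ x ^ 2 = amplitude p q e ^ (2 / (q - p)) *
      (((q - p) * √(2 / (p + 1) * amplitude p q e ^ ((p - 1) / (q - p))))⁻¹ *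
        massIntegral ((q - 1) / (q - p)) (2 / (q - p)) e) := by
  have hk := one_lt_exponent hp hpq
  have hC := amplitude_pos hp hpq he
  have hr : 0 < q - p := by linarith
  have hp1 : 0 < p + 1 := by linarith
  set V : ℝ → ℝ := fun x => φ x ^ (q - p) / amplitude p q e with hVdef
  have hV0 : ∀ x, 0 < V x := fun x => div_pos (Real.rpow_pos_of_pos (h.pos x) _) hC
  have hφV : ∀ x, φ x ^ (q - p) = amplitude p q e * V x := fun x => (mul_div_cancel₀ _ hC.ne').symm
  have hVφ : ∀ x, φ x ^ (q - p - 1) = amplitude p q e * V x / φ x := fun x => by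
    rw [← hφV, Real.rpow_sub_one (h.pos x).ne']
  have key := setIntegral_rpow_eq_massIntegral (V := V) (V' := fun x => (q - p) * V x / φ x * ψ x)
    (x₀ := x₀) (m := 2 / (q - p)) hk hr
    (show 0 < 2 / (p + 1) * amplitude p q e ^ ((p - 1) / (q - p)) by positivity) he ?_ hV0 ?_ ?_
    ?_ ?_
  · rw [← key, ← integral_const_mul]
    refine setIntegral_congr_fun measurableSet_Ioi fun x _ => ?_
    rw [← Real.mul_rpow hC.le (hV0 x).le, ← rpow_eq_of_rpow_sub hpq (h.pos x) (hφV x),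
      Real.rpow_two]
  · intro x
    refine (((h.hasDerivAt x).rpow_const (Or.inl (h.pos x).ne')).div_const _).congr_deriv ?_
    rw [hVφ]
    field_simp
  · simp only [hVdef, hx₀, div_self hC.ne']
  · have := (Real.continuousAt_rpow_const 0 (q - p) (Or.inr hr.le)).tendsto.comp h.tendsto_atTop
    rw [Real.zero_rpow hr.ne'] at this
    simpa using this.div_const (amplitude p q e)
  · exact fun x hx => (div_lt_one hC).2 (hlt x hx)
  · intro x
    have hφ := h.pos x
    rw [mul_pow, h.first_integral hp hpq, first_integral_eq_weight hp hpq he hφ (hV0 x) (hφV x)]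
    field_simp

/-- The mass of a profile in terms of the parameter `e`. -/
theorem half_integral_sq (hp : 1 < p) (hpq : p < q) (he : 0 < e)
    (h : IsProfileSolution p q (frequency p q e) φ ψ) :
    1 / 2 * ∫ x, φ x ^ 2 = ((q - p) * √(2 / (p + 1)))⁻¹ *
      (amplitude p q e ^ ((5 - p) / (2 * (q - p))) *
        massIntegral ((q - 1) / (q - p)) (2 / (q - p)) e) := by
  have hC := amplitude_pos hp hpq he
  have hr : 0 < q - p := by linarith
  have hp1 : 0 < p + 1 := by linarith
  obtain ⟨x₀, hx₀, hlt⟩ := h.exists_unique_max hp hpq he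
  have h1 := h.setIntegral_sq hp hpq he hx₀ fun x hx => hlt x hx.ne'
  -- The left half-line is the right half-line of the reflected profile, so the two contributions
  -- coincide.
  have h2 := h.comp_neg.setIntegral_sq hp hpq he (x₀ := -x₀) (by simpa using hx₀)
    fun x hx => hlt _ (by linarith)
  rw [integral_comp_neg_Ioi (-x₀) (fun x => φ x ^ 2), neg_neg] at h2
  have hint := h.memLp.integrable_sq
  rw [← intervalIntegral.integral_Iic_add_Ioi hint.integrableOn hint.integrableOn (b := x₀), h1, h2]
  -- The Jacobian contributes the square root of a power of the amplitude to the denominator, which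
  -- lowers the exponent `2/(q-p)` to `(5-p)/(2(q-p))`.
  have e1 : √(amplitude p q e ^ ((p - 1) / (q - p))) * amplitude p q e ^ ((5 - p) / (2 * (q - p))) =
      amplitude p q e ^ (2 / (q - p)) := by
    rw [Real.sqrt_eq_rpow, ← Real.rpow_mul hC.le, ← Real.rpow_add hC]
    congr 1
    field_simp
    ring
  rw [Real.sqrt_mul (by positivity), ← e1]
  have e2 : 0 < √(2 / (p + 1)) := Real.sqrt_pos.2 (by positivity)
  have e3 : 0 < √(amplitude p q e ^ ((p - 1) / (q - p))) := Real.sqrt_pos.2 (by positivity)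
  field_simp
  ring

end IsProfileSolution

/-! ### Existence of profiles -/

/-- Separation of variables: `y` is the inverse of `X(y) = ∫₀^y 1/G`. The lower bound makes `X` well
defined and increasing, and the upper bound makes it onto `ℝ`, so the solution is global with `G`
merely continuous. -/
theorem exists_autonomous_ode_solution {G : ℝ → ℝ} {a b : ℝ} (hG : Continuous G) (ha : 0 < a)
    (haG : ∀ y, a ≤ G y) (hGb : ∀ y, G y ≤ b) :
    ∃ y : ℝ → ℝ, y 0 = 0 ∧ ∀ x, HasDerivAt y (G (y x)) x := by
  have hpos : ∀ y, 0 < G y := fun y => ha.trans_le (haG y)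
  have hb : 0 < b := (hpos 0).trans_le (hGb 0)
  have hGi : Continuous fun y => (G y)⁻¹ := hG.inv₀ fun y => (hpos y).ne'
  set X : ℝ → ℝ := fun y => ∫ t in (0 : ℝ)..y, (G t)⁻¹ with hXdef
  have hX : ∀ y, HasDerivAt X (G y)⁻¹ y := fun y => hGi.integral_hasStrictDerivAt 0 y |>.hasDerivAt
  have hXc : Continuous X := continuous_iff_continuousAt.2 fun y => (hX y).continuousAt
  have hX0 : X 0 = 0 := by simp [hXdef]
  have hmono : StrictMono X := strictMono_of_deriv_pos fun y => by
    rw [(hX y).deriv]; exact inv_pos.2 (hpos y)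
  have hle : Monotone fun y => X y - b⁻¹ * y := by
    have hd : ∀ y, HasDerivAt (fun y => X y - b⁻¹ * y) ((G y)⁻¹ - b⁻¹) y := fun y => 
      ((hX y).sub ((hasDerivAt_id y).const_mul b⁻¹)).congr_deriv (by simp)
    refine monotone_of_deriv_nonneg (fun y => (hd y).differentiableAt) fun y => ?_
    rw [(hd y).deriv, sub_nonneg]
    exact inv_anti₀ (hpos y) (hGb y)
  have htop : Tendsto X atTop atTop := by
    refine tendsto_atTop_mono' _ ?_ (tendsto_id.const_mul_atTop (inv_pos.2 hb))
    filter_upwards [eventually_ge_atTop 0] with y hy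
    have := hle hy
    simp only [hX0, mul_zero, sub_zero] at this
    simpa using this
  have hbot : Tendsto X atBot atBot := by
    refine tendsto_atBot_mono' _ ?_ (tendsto_id.const_mul_atBot (inv_pos.2 hb))
    filter_upwards [eventually_le_atBot 0] with y hy
    have := hle hy
    simp only [hX0, mul_zero, sub_zero] at this
    simpa using this
  set T := hmono.orderIsoOfSurjective X (hXc.surjective htop hbot) with hT
  have hXT : ∀ x, X (T.symm x) = x := fun x => T.apply_symm_apply x
  refine ⟨T.symm, hmono.injective (by rw [hXT, hX0]), fun x => ?_⟩
  have := (hX (T.symm x)).of_local_left_inverse T.symm.continuous.continuousAt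
    (inv_ne_zero (hpos _).ne') (Eventually.of_forall hXT)
  rwa [inv_inv] at this

/-- Near a nonzero value the sign of `ψ` is constant, so `ψ = ±√g` locally. -/
theorem hasDerivAt_of_sq {ψ g : ℝ → ℝ} {f x : ℝ} (hψ : ContinuousAt ψ x) (hne : ψ x ≠ 0)
    (hg : ∀ y, ψ y ^ 2 = g y) (hd : HasDerivAt g (2 * ψ x * f) x) : HasDerivAt ψ f x := by
  have hgx : g x ≠ 0 := by rw [← hg]; positivity
  have hs := hd.sqrt hgx
  rw [← hg, Real.sqrt_sq_eq_abs] at hs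
  rcases lt_or_gt_of_ne hne with h | h
  · have hev : ψ =ᶠ[𝓝 x] fun y => -√(g y) := by
      filter_upwards [hψ.eventually (gt_mem_nhds h)] with y hy
      rw [← hg, Real.sqrt_sq_eq_abs, abs_of_neg hy, neg_neg]
    refine (hs.neg.congr_deriv ?_).congr_of_eventuallyEq hev
    rw [abs_of_neg h]
    field_simp
  · have hev : ψ =ᶠ[𝓝 x] fun y => √(g y) := by
      filter_upwards [hψ.eventually (lt_mem_nhds h)] with y hy
      rw [← hg, Real.sqrt_sq_eq_abs, abs_of_pos hy]
    refine (hs.congr_deriv ?_).congr_of_eventuallyEq hev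
    rw [abs_of_pos h]
    field_simp

theorem integrable_exp_neg_mul_abs {b : ℝ} (hb : 0 < b) :
    Integrable fun x : ℝ => Real.exp (-b * |x|) := by
  rw [← integrableOn_univ, ← Iic_union_Ioi (a := (0 : ℝ)), integrableOn_union]
  constructor
  · refine (integrableOn_exp_mul_Iic hb 0).congr_fun (fun x hx => ?_) measurableSet_Iic
    simp only
    rw [abs_of_nonpos hx, neg_mul_neg]
  · refine (exp_neg_integrableOn_Ioi 0 hb).congr_fun (fun x hx => ?_) measurableSet_Ioi
    simp only
    rw [abs_of_pos hx]

/-- The continuous extension to `v = 1` of `weight k e v / (1 - v)`. -/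
noncomputable def weightQuotient (k e v : ℝ) : ℝ :=
  e * dslope (fun v : ℝ => v ^ k) 1 v + v ^ (k - 1)

theorem one_sub_mul_weightQuotient (k e v : ℝ) :
    (1 - v) * weightQuotient k e v = weight k e v := by
  have := sub_smul_dslope (fun v : ℝ => v ^ k) 1 v
  simp only [smul_eq_mul, Real.one_rpow] at this
  unfold weightQuotient weight
  linear_combination -e * this

theorem continuousAt_weightQuotient (k e : ℝ) {v : ℝ} (hv : 0 < v) :
    ContinuousAt (weightQuotient k e) v := by
  have h1 : ContinuousAt (dslope (fun v : ℝ => v ^ k) 1) v := by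
    rcases eq_or_ne v 1 with rfl | h
    · exact continuousAt_dslope_same.2
        (Real.differentiableAt_rpow_const_of_ne k one_ne_zero)
    · exact (continuousAt_dslope_of_ne h).2 (Real.continuousAt_rpow_const v k (Or.inl hv.ne'))
  exact (h1.const_mul e).add (Real.continuousAt_rpow_const v (k - 1) (Or.inl hv.ne'))

theorem dslope_rpow_mem_Icc {k v : ℝ} (hk : 1 < k) (hv : v ∈ Ioc (0 : ℝ) 1) :
    dslope (fun v : ℝ => v ^ k) 1 v ∈ Icc 1 k := by
  rcases eq_or_lt_of_le hv.2 with rfl | h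
  · rw [dslope_same, (Real.hasDerivAt_rpow_const (Or.inl one_ne_zero)).deriv, Real.one_rpow, mul_one]
    exact ⟨hk.le, le_rfl⟩
  · have hv' : v ∈ Ioo (0 : ℝ) 1 := ⟨hv.1, h⟩
    have h0 : 0 < 1 - v := by linarith
    rw [dslope_of_ne _ h.ne, slope_def_field, Real.one_rpow, ← neg_div_neg_eq, neg_sub, neg_sub,
      mem_Icc, le_div_iff₀ h0, div_le_iff₀ h0, one_mul]
    exact ⟨one_sub_le_one_sub_rpow hk hv', one_sub_rpow_le hk hv'⟩

theorem weightQuotient_mem_Icc {k e v : ℝ} (hk : 1 < k) (he : 0 < e) (hv : v ∈ Ioc (0 : ℝ) 1) :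
    weightQuotient k e v ∈ Icc e (e * k + 1) := by
  obtain ⟨h1, h2⟩ := dslope_rpow_mem_Icc hk hv
  have h3 := Real.rpow_pos_of_pos hv.1 (k - 1)
  have h4 : v ^ (k - 1) ≤ 1 := Real.rpow_le_one hv.1.le hv.2 (by linarith)
  unfold weightQuotient
  constructor <;> nlinarith

/-- The equation `φ' = ∓φ √(c w)` degenerates at the maximum, where `w` has a simple zero. Writing
`V = cosh(y)^(-2)` turns `1 - V` into `tanh(y)²`, whose square root is smooth and changes sign at `y
= 0`. What remains is `y' = S(y)/m` with `S` continuous and bounded between positive constants. -/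
theorem exists_isProfileSolution {p q e : ℝ} (hp : 1 < p) (hpq : p < q) (he : 0 < e) :
    ∃ φ ψ, IsProfileSolution p q (frequency p q e) φ ψ := by
  have hk := one_lt_exponent hp hpq
  have hC := amplitude_pos hp hpq he
  have hr : 0 < q - p := by linarith
  have hp1 : 0 < p + 1 := by linarith
  have hq1 : 0 < q + 1 := by linarith
  set k := (q - 1) / (q - p) with hkdef
  set m := 2 / (q - p) with hm
  have hm0 : 0 < m := by positivity
  set c := 2 / (p + 1) * amplitude p q e ^ ((p - 1) / (q - p)) with hc
  have hc0 : 0 < c := by positivity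
  set a := amplitude p q e ^ (1 / (q - p)) with ha
  have ha0 : 0 < a := Real.rpow_pos_of_pos hC _
  set v : ℝ → ℝ := fun y => (Real.cosh y ^ 2)⁻¹ with hvdef
  have hv : ∀ y, v y ∈ Ioc (0 : ℝ) 1 := fun y => by
    have := Real.one_le_cosh y
    exact ⟨by positivity, inv_le_one_of_one_le₀ (one_le_pow₀ this)⟩
  have hvc : Continuous v := 
    (Real.continuous_cosh.pow 2).inv₀ fun y => (pow_pos (Real.cosh_pos y) 2).ne'
  set S : ℝ → ℝ := fun y => √(c * weightQuotient k e (v y)) with hS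
  have hSc : Continuous S := by
    refine Real.continuous_sqrt.comp (continuous_const.mul ?_)
    exact continuous_iff_continuousAt.2 fun y =>
      (continuousAt_weightQuotient k e (hv y).1).comp hvc.continuousAt
  have hSlow : ∀ y, √(c * e) ≤ S y := fun y => by
    have := (weightQuotient_mem_Icc hk he (hv y)).1
    exact Real.sqrt_le_sqrt (by gcongr)
  have hSup : ∀ y, S y ≤ √(c * (e * k + 1)) := fun y => by
    have := (weightQuotient_mem_Icc hk he (hv y)).2
    exact Real.sqrt_le_sqrt (by gcongr)
  have hce : 0 < √(c * e) := Real.sqrt_pos.2 (by positivity)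
  obtain ⟨y, hy0, hy⟩ := exists_autonomous_ode_solution (G := fun y => m⁻¹ * S y)
    (a := m⁻¹ * √(c * e)) (b := m⁻¹ * √(c * (e * k + 1))) (continuous_const.mul hSc) (by positivity)
    (fun y => by have := hSlow y; gcongr) (fun y => by have := hSup y; gcongr)
  have hyc : Continuous y := continuous_iff_continuousAt.2 fun x => (hy x).continuousAt
  have hSpos : ∀ y, 0 < S y := fun y => hce.trans_le (hSlow y)
  have hymono : StrictMono y := strictMono_of_deriv_pos fun x => by
    have := hSpos (y x)
    rw [(hy x).deriv]; positivity
  have hgrow : Monotone fun x => y x - m⁻¹ * √(c * e) * x := by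
    have hd : ∀ x, HasDerivAt (fun x => y x - m⁻¹ * √(c * e) * x)
        (m⁻¹ * S (y x) - m⁻¹ * √(c * e)) x := fun x => 
      ((hy x).sub ((hasDerivAt_id x).const_mul (m⁻¹ * √(c * e)))).congr_deriv (by simp)
    refine monotone_of_deriv_nonneg (fun x => (hd x).differentiableAt) fun x => ?_
    have := hSlow (y x)
    rw [(hd x).deriv, sub_nonneg]
    gcongr
  -- At least linear growth of `y` gives exponential decay of `cosh(y)^(-m)`, hence square
  -- integrability of the profile.
  have habs : ∀ x, m⁻¹ * √(c * e) * |x| ≤ |y x| := fun x => by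
    rcases le_total 0 x with hx | hx
    · have := hgrow hx
      simp only [hy0, mul_zero, sub_zero] at this
      rw [abs_of_nonneg hx]
      exact le_trans (by linarith) (le_abs_self _)
    · have := hgrow hx
      simp only [hy0, mul_zero, sub_zero] at this
      rw [abs_of_nonpos hx]
      exact le_trans (by linarith) (neg_le_abs _)
  set φ : ℝ → ℝ := fun x => a * Real.cosh (y x) ^ (-m) with hφ
  set ψ : ℝ → ℝ := fun x => -(φ x * (Real.tanh (y x) * S (y x))) with hψ
  have hφ0 : ∀ x, 0 < φ x := fun x => mul_pos ha0 (Real.rpow_pos_of_pos (Real.cosh_pos _) _)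
  have hφc : Continuous φ := continuous_const.mul
    ((Real.continuous_cosh.comp hyc).rpow_const fun x => Or.inl (Real.cosh_pos _).ne')
  have htc : Continuous Real.tanh := by
    rw [funext Real.tanh_eq_sinh_div_cosh]
    exact Real.continuous_sinh.div Real.continuous_cosh fun y => (Real.cosh_pos y).ne'
  have hψc : Continuous ψ := (hφc.mul ((htc.comp hyc).mul (hSc.comp hyc))).neg
  have hdφ : ∀ x, HasDerivAt φ (ψ x) x := fun x => by
    have hch := Real.cosh_pos (y x)
    have h1 := (((Real.hasDerivAt_cosh (y x)).comp x (hy x)).rpow_const (p := -m)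
      (Or.inl hch.ne')).const_mul a
    refine h1.congr_deriv ?_
    simp only [hψ, hφ, Function.comp_apply]
    rw [Real.rpow_sub_one hch.ne', Real.tanh_eq_sinh_div_cosh]
    field_simp
  have hφr : ∀ x, φ x ^ (q - p) = amplitude p q e * v (y x) := fun x => by
    have hch := Real.cosh_pos (y x)
    simp only [hφ, hvdef]
    rw [Real.mul_rpow ha0.le (Real.rpow_nonneg hch.le _), ha, ← Real.rpow_mul hC.le,
      one_div_mul_cancel hr.ne', Real.rpow_one, ← Real.rpow_mul hch.le, ← Real.rpow_two,
      ← Real.rpow_neg hch.le]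
    congr 2
    rw [hm]
    field_simp
  set F : ℝ → ℝ := fun s => frequency p q e * s ^ 2 + 2 / (p + 1) * s ^ (p + 1) -
    2 / (q + 1) * s ^ (q + 1) with hF
  have hψ2 : ∀ x, ψ x ^ 2 = F (φ x) := fun x => by
    have hch := Real.cosh_pos (y x)
    have h1 := first_integral_eq_weight hp hpq he (hφ0 x) (hv (y x)).1 (hφr x)
    have h2 : Real.tanh (y x) ^ 2 = 1 - v (y x) := by
      rw [Real.tanh_eq_sinh_div_cosh, div_pow, Real.sinh_sq]
      simp only [hvdef]
      field_simp
    have h3 : S (y x) ^ 2 = c * weightQuotient k e (v (y x)) :=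
      Real.sq_sqrt (mul_nonneg hc0.le (he.le.trans (weightQuotient_mem_Icc hk he (hv (y x))).1))
    have e1 : φ x ^ (p + 1) = φ x ^ 2 * φ x ^ (p - 1) := by
      rw [← Real.rpow_natCast, ← Real.rpow_add (hφ0 x)]; congr 1; push_cast; ring
    have e2 : φ x ^ (q + 1) = φ x ^ 2 * φ x ^ (q - 1) := by
      rw [← Real.rpow_natCast, ← Real.rpow_add (hφ0 x)]; congr 1; push_cast; ring
    rw [← hkdef, ← hc, ← one_sub_mul_weightQuotient] at h1
    simp only [hF, e1, e2]
    rw [hψ]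
    linear_combination (φ x ^ 2 * S (y x) ^ 2) * h2 + φ x ^ 2 * (1 - v (y x)) * h3 - φ x ^ 2 * h1
  -- `S` is only known to be continuous, so `ψ` is not differentiated directly: the second-order
  -- equation comes from `ψ² = F(φ)` where `ψ ≠ 0`, that is for `x ≠ 0`. It extends to `x = 0` at
  -- the end because its right-hand side is continuous.
  have hdψ : ∀ x, x ≠ 0 → HasDerivAt ψ (frequency p q e * φ x + φ x ^ p - φ x ^ q) x := by
    intro x hx
    have hyx : y x ≠ 0 := fun h => hx (hymono.injective (h.trans hy0.symm))
    have htanh : Real.tanh (y x) ≠ 0 := by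
      rw [Real.tanh_eq_sinh_div_cosh]
      exact div_ne_zero (fun h => hyx (Real.sinh_eq_zero.1 h)) (Real.cosh_pos _).ne'
    have hne : ψ x ≠ 0 :=
      neg_ne_zero.2 (mul_ne_zero (hφ0 x).ne' (mul_ne_zero htanh (hSpos _).ne'))
    refine hasDerivAt_of_sq hψc.continuousAt hne hψ2 ?_
    have d0 := hdφ x
    have d1 := (d0.rpow_const (p := p + 1) (Or.inl (hφ0 x).ne')).const_mul (2 / (p + 1))
    have d2 := (d0.rpow_const (p := q + 1) (Or.inl (hφ0 x).ne')).const_mul (2 / (q + 1))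
    refine (((d0.pow 2).const_mul (frequency p q e)).add d1).sub d2 |>.congr_deriv ?_
    simp only [add_sub_cancel_right]
    field_simp
    push_cast
    ring
  have hfc : Continuous fun x => frequency p q e * φ x + φ x ^ p - φ x ^ q :=
    ((continuous_const.mul hφc).add (hφc.rpow_const fun x => Or.inl (hφ0 x).ne')).sub
      (hφc.rpow_const fun x => Or.inl (hφ0 x).ne')
  have hL2 : MemLp φ 2 volume := by
    have hb : 0 < √(c * e) := hce
    have hexp : MemLp (fun x : ℝ => Real.exp (-√(c * e) * |x|)) 2 volume := by
      rw [memLp_two_iff_integrable_sq (Continuous.aestronglyMeasurable (by fun_prop))]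
      refine (integrable_exp_neg_mul_abs (mul_pos two_pos hb)).congr (ae_of_all _ fun x => ?_)
      simp only
      rw [← Real.exp_nat_mul]
      congr 1
      push_cast
      ring
    refine hexp.of_le_mul (c := a * 2 ^ m) hφc.aestronglyMeasurable (ae_of_all _ fun x => ?_)
    have hch : Real.exp |y x| / 2 ≤ Real.cosh (y x) := by
      rw [← Real.cosh_abs, Real.cosh_eq]
      have := Real.exp_pos (-|y x|)
      linarith
    have h1 : Real.cosh (y x) ^ (-m) ≤ (Real.exp |y x| / 2) ^ (-m) :=
      Real.rpow_le_rpow_of_nonpos (by positivity) hch (by linarith)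
    have h2 : (Real.exp |y x| / 2) ^ (-m) = 2 ^ m * Real.exp (-m * |y x|) := by
      rw [Real.div_rpow (Real.exp_pos _).le (by norm_num), ← Real.exp_mul,
        Real.rpow_neg (by norm_num), div_inv_eq_mul, mul_comm, mul_comm |y x|]
    have h3 : Real.exp (-m * |y x|) ≤ Real.exp (-√(c * e) * |x|) := by
      refine Real.exp_le_exp.2 ?_
      have h4 := mul_le_mul_of_nonneg_left (habs x) hm0.le
      have h5 : m * (m⁻¹ * √(c * e) * |x|) = √(c * e) * |x| := by field_simp
      linarith
    rw [Real.norm_of_nonneg (hφ0 x).le, Real.norm_of_nonneg (Real.exp_pos _).le]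
    calc φ x ≤ a * (2 ^ m * Real.exp (-√(c * e) * |x|)) := by
          simp only [hφ]
          rw [h2] at h1
          have h6 : (0 : ℝ) ≤ 2 ^ m := by positivity
          exact mul_le_mul_of_nonneg_left (h1.trans (mul_le_mul_of_nonneg_left h3 h6)) ha0.le
      _ = _ := by ring
  refine ⟨φ, ψ, hφ0, hL2, ?_, hdφ, hasDerivAt_of_hasDerivAt_of_ne' hdψ hψc.continuousAt
    hfc.continuousAt⟩
  refine hL2.of_le_mul (c := √(c * (e * k + 1))) hψc.aestronglyMeasurable
    (ae_of_all _ fun x => ?_)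
  have ht : |Real.tanh (y x)| ≤ 1 := (Real.abs_tanh_lt_one _).le
  rw [show ψ x = -(φ x * (Real.tanh (y x) * S (y x))) from rfl, norm_neg, norm_mul (φ x),
    norm_mul (Real.tanh _), Real.norm_eq_abs (Real.tanh _),
    Real.norm_of_nonneg (hSpos _).le]
  calc ‖φ x‖ * (|Real.tanh (y x)| * S (y x)) ≤ ‖φ x‖ * (1 * √(c * (e * k + 1))) := by
        have := hSup (y x)
        have := (hSpos (y x)).le
        gcongr
    _ = _ := by ring

/-! ### The frequency as a parameter -/

variable {p q : ℝ}

/-- The derivative of `frequency`. -/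
noncomputable def frequencyDeriv (p q e : ℝ) : ℝ :=
  2 / (p + 1) * (((q + 1) / (p + 1)) * ((p - 1) / (q - p)) *
    amplitude p q e ^ ((p - 1) / (q - p) - 1) * e + amplitude p q e ^ ((p - 1) / (q - p)))

theorem hasDerivAt_amplitude (p q e : ℝ) :
    HasDerivAt (amplitude p q) ((q + 1) / (p + 1)) e := by
  unfold amplitude
  exact (((hasDerivAt_id e).const_add 1).const_mul _).congr_deriv (by simp)

theorem hasDerivAt_frequency (hp : 1 < p) (hpq : p < q) {e : ℝ} (he : 0 < e) :
    HasDerivAt (frequency p q) (frequencyDeriv p q e) e := by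
  have h1 := ((hasDerivAt_amplitude p q e).rpow_const (p := (p - 1) / (q - p))
    (Or.inl (amplitude_pos hp hpq he).ne')).const_mul (2 / (p + 1))
  refine (h1.mul (hasDerivAt_id e)).congr_deriv ?_
  simp only [frequencyDeriv, id]
  ring

theorem frequencyDeriv_pos (hp : 1 < p) (hpq : p < q) {e : ℝ} (he : 0 < e) :
    0 < frequencyDeriv p q e := by
  have := amplitude_pos hp hpq he
  have : 0 < p + 1 := by linarith
  have : 0 < q + 1 := by linarith
  have : 0 < p - 1 := by linarith
  have : 0 < q - p := by linarith
  unfold frequencyDeriv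
  positivity

theorem continuous_amplitude (p q : ℝ) : Continuous (amplitude p q) := by
  unfold amplitude; fun_prop

theorem strictMonoOn_frequency (hp : 1 < p) (hpq : p < q) :
    StrictMonoOn (frequency p q) (Ioi 0) := by
  refine strictMonoOn_of_deriv_pos (convex_Ioi 0)
    (fun e he => (hasDerivAt_frequency hp hpq he).continuousAt.continuousWithinAt) fun e he => ?_
  rw [interior_Ioi] at he
  rw [(hasDerivAt_frequency hp hpq he).deriv]
  exact frequencyDeriv_pos hp hpq he

theorem exists_frequency_eq (hp : 1 < p) (hpq : p < q) {ω : ℝ} (hω : 0 < ω) :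
    ∃ e, 0 < e ∧ frequency p q e = ω := by
  have hκ : 0 < (p - 1) / (q - p) := div_pos (by linarith) (by linarith)
  have hp1 : 0 < p + 1 := by linarith
  have hθ : 1 < (q + 1) / (p + 1) := by rw [one_lt_div hp1]; linarith
  have hcont : Continuous (frequency p q) := by
    unfold frequency
    exact (continuous_const.mul ((continuous_amplitude p q).rpow_const fun _ =>
      Or.inr hκ.le)).mul continuous_id
  -- Since the amplitude is at least `1`, `frequency p q b ≥ 2/(p+1) · b = ω`, which brackets `ω`
  -- for the intermediate value theorem.
  set b := (p + 1) / 2 * ω with hb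
  have hb0 : 0 < b := by positivity
  have hge : ω ≤ frequency p q b := by
    have h1 : 1 ≤ amplitude p q b ^ ((p - 1) / (q - p)) := by
      refine Real.one_le_rpow ?_ hκ.le
      unfold amplitude
      nlinarith
    have h2 : 2 / (p + 1) * b = ω := by rw [hb]; field_simp
    calc ω = 2 / (p + 1) * 1 * b := by rw [mul_one, h2]
      _ ≤ _ := by unfold frequency; gcongr
  obtain ⟨e, he, hfe⟩ := intermediate_value_Icc hb0.le hcont.continuousOn
    (show ω ∈ Icc (frequency p q 0) (frequency p q b) from ⟨by simp [frequency, hω.le], hge⟩)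
  refine ⟨e, lt_of_le_of_ne he.1 fun h0 => ?_, hfe⟩
  rw [← h0] at hfe
  simp only [frequency, mul_zero] at hfe
  exact hω.ne hfe

theorem frequency_inverse_lt {E : ℝ → ℝ} (hp : 1 < p) (hpq : p < q)
    (hE : ∀ ω, 0 < ω → 0 < E ω ∧ frequency p q (E ω) = ω) {ω e : ℝ} (hω : 0 < ω) (he : 0 < e) (h : ω < frequency p q e) :
    E ω < e := by
  rw [← (hE ω hω).2] at h
  exact ((strictMonoOn_frequency hp hpq).lt_iff_lt (hE ω hω).1 he).1 h

/-- `E` is monotone with image containing `(0,∞)`, hence continuous; the derivative of an inverse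
function then applies. -/
theorem hasDerivAt_frequency_inverse {E : ℝ → ℝ} (hp : 1 < p) (hpq : p < q)
    (hE : ∀ ω, 0 < ω → 0 < E ω ∧ frequency p q (E ω) = ω) {ω : ℝ} (hω : 0 < ω) :
    HasDerivAt E (frequencyDeriv p q (E ω))⁻¹ ω := by
  have hmono : StrictMonoOn E (Ioi 0) := fun a ha b hb hab =>
    frequency_inverse_lt hp hpq hE ha (hE b hb).1 (by rwa [(hE b hb).2])
  have himg : Ioi 0 ⊆ E '' Ioi 0 := fun e he => by
    have hf := frequency_pos hp hpq he
    exact ⟨frequency p q e, hf,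
      (strictMonoOn_frequency hp hpq).injOn (hE _ hf).1 he (hE _ hf).2⟩
  have hcont : ContinuousAt E ω := hmono.continuousAt_of_image_mem_nhds (Ioi_mem_nhds hω)
    (mem_of_superset (Ioi_mem_nhds (hE ω hω).1) himg)
  refine (hasDerivAt_frequency hp hpq (hE ω hω).1).of_local_left_inverse hcont
    (frequencyDeriv_pos hp hpq (hE ω hω).1).ne' ?_
  filter_upwards [Ioi_mem_nhds hω] with x hx using (hE x hx).2

theorem tendsto_frequency_inverse {E : ℝ → ℝ} (hp : 1 < p) (hpq : p < q)
    (hE : ∀ ω, 0 < ω → 0 < E ω ∧ frequency p q (E ω) = ω) : Tendsto E (𝓝[>] 0) (𝓝[>] 0) := by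
  refine tendsto_nhdsWithin_iff.2 ⟨?_, ?_⟩
  · refine tendsto_order.2 ⟨fun a ha => ?_, fun a ha => ?_⟩
    · filter_upwards [self_mem_nhdsWithin] with ω hω using ha.trans (hE ω hω).1
    · filter_upwards [Ioo_mem_nhdsGT (frequency_pos hp hpq ha)] with ω hω using
        frequency_inverse_lt hp hpq hE hω.1 ha hω.2
  · filter_upwards [self_mem_nhdsWithin] with ω hω using (hE ω hω).1

/-! ### The derivative of the mass -/

/-- The mass as a function of the parameter `e`. -/
noncomputable def parametricMass (p q e : ℝ) : ℝ :=
  ((q - p) * √(2 / (p + 1)))⁻¹ * (amplitude p q e ^ ((5 - p) / (2 * (q - p))) *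
    massIntegral ((q - 1) / (q - p)) (2 / (q - p)) e)

/-- The derivative of `parametricMass`. -/
noncomputable def parametricMassDeriv (p q e : ℝ) : ℝ :=
  ((q - p) * √(2 / (p + 1)))⁻¹ *
    ((q + 1) / (p + 1) * ((5 - p) / (2 * (q - p))) *
      amplitude p q e ^ ((5 - p) / (2 * (q - p)) - 1) *
        massIntegral ((q - 1) / (q - p)) (2 / (q - p)) e +
      amplitude p q e ^ ((5 - p) / (2 * (q - p))) *
        (-1 / 2 * massIntegralDeriv ((q - 1) / (q - p)) (2 / (q - p)) e))

theorem beta_exponent (hpq : p < q) :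
    2 / (q - p) - ((q - 1) / (q - p) - 1) / 2 = (5 - p) / (2 * (q - p)) := by
  rw [exponent_sub_one hpq]
  have : q - p ≠ 0 := by linarith
  field_simp
  ring

theorem alpha_exponent (hpq : p < q) :
    2 / (q - p) - 3 * ((q - 1) / (q - p) - 1) / 2 = (7 - 3 * p) / (2 * (q - p)) := by
  rw [exponent_sub_one hpq]
  have : q - p ≠ 0 := by linarith
  field_simp
  ring

theorem beta_exponent_pos (hpq : p < q) (hq : q < 5) :
    0 < 2 / (q - p) - ((q - 1) / (q - p) - 1) / 2 := by
  rw [beta_exponent hpq]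
  exact div_pos (by linarith) (by linarith)

theorem hasDerivAt_parametricMass (hp : 1 < p) (hpq : p < q) (hq : q < 5) {e : ℝ} (he : 0 < e) :
    HasDerivAt (parametricMass p q) (parametricMassDeriv p q e) e := by
  have h1 := (hasDerivAt_amplitude p q e).rpow_const (p := (5 - p) / (2 * (q - p)))
    (Or.inl (amplitude_pos hp hpq he).ne')
  exact (h1.mul (hasDerivAt_massIntegral (one_lt_exponent hp hpq) (beta_exponent_pos hpq hq)
    he)).const_mul _

theorem amplitude_zero (p q : ℝ) : amplitude p q 0 = (q + 1) / (p + 1) := by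
  simp [amplitude]

theorem tendsto_amplitude_rpow (hp : 1 < p) (hpq : p < q) (s : ℝ) :
    Tendsto (fun e => amplitude p q e ^ s) (𝓝[>] 0) (𝓝 (((q + 1) / (p + 1)) ^ s)) := by
  have hθ : 0 < (q + 1) / (p + 1) := div_pos (by linarith) (by linarith)
  have h := (continuous_amplitude p q).continuousAt (x := 0)
  have := (h.rpow_const (p := s) (Or.inl (by rw [amplitude_zero]; exact hθ.ne'))).tendsto
  rw [amplitude_zero] at this
  exact this.mono_left nhdsWithin_le_nhds

theorem tendsto_frequencyDeriv (hp : 1 < p) (hpq : p < q) :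
    Tendsto (frequencyDeriv p q) (𝓝[>] 0)
      (𝓝 (2 / (p + 1) * ((q + 1) / (p + 1)) ^ ((p - 1) / (q - p)))) := by
  have h0 : Tendsto (fun e : ℝ => e) (𝓝[>] 0) (𝓝 0) := nhdsWithin_le_nhds
  have h1 := tendsto_amplitude_rpow hp hpq ((p - 1) / (q - p) - 1)
  have h2 := tendsto_amplitude_rpow hp hpq ((p - 1) / (q - p))
  have := ((((h1.const_mul ((q + 1) / (p + 1) * ((p - 1) / (q - p)))).mul h0).add h2).const_mul
    (2 / (p + 1)))
  simpa only [mul_zero, zero_add] using! this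

theorem limitConst_pos (hp : 1 < p) (hpq : p < q) : 0 < limitConst p q := by
  have : 0 < p + 1 := by linarith
  have : 0 < q + 1 := by linarith
  have : 0 < q - p := by linarith
  have := Real.pi_pos
  unfold limitConst
  positivity

/-- The constant in the mass formula, with the `√π` from the gamma quotient, over the limit of
`dω/de`. The exponent in `c_{p,q}` arises as `β - (p-1)/(q-p) = α`. -/
theorem limitConst_eq (hp : 1 < p) (hpq : p < q) :
    ((q - p) * √(2 / (p + 1)))⁻¹ * (((q + 1) / (p + 1)) ^ ((5 - p) / (2 * (q - p))) * √Real.pi) /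
      (2 / (p + 1) * ((q + 1) / (p + 1)) ^ ((p - 1) / (q - p))) = limitConst p q := by
  have hp1 : 0 < p + 1 := by linarith
  have hr : 0 < q - p := by linarith
  have hθ : 0 < (q + 1) / (p + 1) := div_pos (by linarith) hp1
  have e1 : (5 - p) / (2 * (q - p)) = (7 - 3 * p) / (2 * (q - p)) + (p - 1) / (q - p) := by
    field_simp; ring
  have e2 : (p + 1) ^ (3 / 2 : ℝ) = (p + 1) * √(p + 1) := by
    rw [Real.sqrt_eq_rpow, ← Real.rpow_one_add' hp1.le (by norm_num)]; norm_num
  have e3 : √(2 / (p + 1)) = √2 / √(p + 1) := Real.sqrt_div (by norm_num) _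
  have e4 : √2 * √2 = (2 : ℝ) := Real.mul_self_sqrt (by norm_num)
  have hP := Real.rpow_pos_of_pos hθ ((p - 1) / (q - p))
  have h2 : 0 < √2 := by positivity
  have h3 : 0 < √(p + 1) := Real.sqrt_pos.2 hp1
  rw [limitConst, e1, Real.rpow_add hθ, e2, e3, Real.sqrt_mul (by norm_num)]
  generalize ((q + 1) / (p + 1)) ^ ((p - 1) / (q - p)) = P at *
  generalize ((q + 1) / (p + 1)) ^ ((7 - 3 * p) / (2 * (q - p))) = Q at *
  field_simp
  linear_combination (-2 * Q) * e4

theorem tendsto_parametricMassDeriv_div (hp : 1 < p) (hpq : p < q) (hq : q < 5) (h7 : p < 7 / 3) :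
    Tendsto (fun e => parametricMassDeriv p q e / frequencyDeriv p q e) (𝓝[>] 0)
      (𝓝 (limitConst p q * (Real.Gamma ((7 - 3 * p) / (2 * (q - p))) /
        Real.Gamma ((7 - 2 * p - q) / (2 * (q - p)))))) := by
  have hk := one_lt_exponent hp hpq
  have hr : 0 < q - p := by linarith
  have hθ : 0 < (q + 1) / (p + 1) := div_pos (by linarith) (by linarith)
  have hβ := beta_exponent_pos hpq hq
  have hα : 0 < 2 / (q - p) - 3 * ((q - 1) / (q - p) - 1) / 2 := by
    rw [alpha_exponent hpq]; exact div_pos (by linarith) (by linarith)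
  have hJ := tendsto_massIntegral hk hβ
  have hJ' := tendsto_massIntegralDeriv hk hα
  rw [massIntegral_zero hβ, beta_exponent hpq] at hJ
  rw [massIntegralDeriv_zero hk hα, beta_exponent hpq, alpha_exponent hpq,
    sub_half_mul_beta_half] at hJ'
  have e1 : (7 - 3 * p) / (2 * (q - p)) - 1 / 2 = (7 - 2 * p - q) / (2 * (q - p)) := by
    field_simp; ring
  rw [e1] at hJ'
  have h1 := tendsto_amplitude_rpow hp hpq ((5 - p) / (2 * (q - p)) - 1)
  have h2 := tendsto_amplitude_rpow hp hpq ((5 - p) / (2 * (q - p)))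
  have hN := (((h1.const_mul ((q + 1) / (p + 1) * ((5 - p) / (2 * (q - p))))).mul hJ).add
    (h2.mul (hJ'.const_mul (-1 / 2)))).const_mul ((q - p) * √(2 / (p + 1)))⁻¹
  have hD := tendsto_frequencyDeriv hp hpq
  have hD0 : 2 / (p + 1) * ((q + 1) / (p + 1)) ^ ((p - 1) / (q - p)) ≠ 0 :=
    (mul_pos (div_pos two_pos (by linarith)) (Real.rpow_pos_of_pos hθ _)).ne'
  have hlim := hN.div hD hD0
  rw [← limitConst_eq hp hpq]
  convert! hlim using 2
  -- With `θ = (q+1)/(p+1)`, the term `θ · β · θ^(β-1) B(β, 1/2)` from the amplitude cancels the `-β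
  -- θ^β B(β, 1/2)` from the mass integral; only the gamma quotient survives.
  rw [Real.rpow_sub_one hθ.ne', div_mul_eq_mul_div]
  congr 1
  have : (q + 1) / (p + 1) ≠ 0 := hθ.ne'
  generalize (q + 1) / (p + 1) = θ at *
  field_simp
  ring

/-- The amplitude term stays bounded because `J(e)` converges, while `-½ ∫ v^(m-1) (1-v^k) w^(-3/2)`
tends to `-∞`; the denominator has a positive limit. -/
theorem tendsto_parametricMassDeriv_div_atBot (hp : 1 < p) (hpq : p < q) (hq : q < 5)
    (h7 : 7 / 3 ≤ p) :
    Tendsto (fun e => parametricMassDeriv p q e / frequencyDeriv p q e) (𝓝[>] 0) atBot := by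
  have hk := one_lt_exponent hp hpq
  have hr : 0 < q - p := by linarith
  have hp1 : 0 < p + 1 := by linarith
  have hθ : 0 < (q + 1) / (p + 1) := div_pos (by linarith) hp1
  have hβ := beta_exponent_pos hpq hq
  have hα : 2 / (q - p) - 3 * ((q - 1) / (q - p) - 1) / 2 ≤ 0 := by
    rw [alpha_exponent hpq]; exact div_nonpos_of_nonpos_of_nonneg (by linarith) (by linarith)
  have hJ := tendsto_massIntegral hk hβ
  have hJ' := tendsto_massIntegralDeriv_atTop hk hβ hα
  have h1 := tendsto_amplitude_rpow hp hpq ((5 - p) / (2 * (q - p)) - 1)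
  have h2 := tendsto_amplitude_rpow hp hpq ((5 - p) / (2 * (q - p)))
  have hN := Tendsto.const_mul_atBot (r := ((q - p) * √(2 / (p + 1)))⁻¹)
    (inv_pos.2 (mul_pos hr (Real.sqrt_pos.2 (by positivity))))
    (((h1.const_mul ((q + 1) / (p + 1) * ((5 - p) / (2 * (q - p))))).mul hJ).add_atBot
      (Tendsto.pos_mul_atBot (Real.rpow_pos_of_pos hθ _) h2
        (hJ'.const_mul_atTop_of_neg (show (-1 / 2 : ℝ) < 0 by norm_num))))
  have hD := tendsto_frequencyDeriv hp hpq
  have hD0 : 0 < 2 / (p + 1) * ((q + 1) / (p + 1)) ^ ((p - 1) / (q - p)) := by positivity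
  exact Tendsto.atBot_mul_pos (inv_pos.2 hD0) hN (hD.inv₀ hD0.ne')

end DoublePowerNLS

/-! ### Conclusion: from the parameter `e` back to the frequency -/

open DoublePowerNLS in
theorem theorem1p1 (p q : ℝ) (hp : 1 < p) (hpq : p < q) (hq : q < 5) :
    (∀ ω : ℝ, 0 < ω → ∃ φ : ℝ → ℝ, DoublePowerNLS.IsStandingWaveProfile p q ω φ) ∧
    ∀ φ : ℝ → ℝ → ℝ,
      (∀ ω : ℝ, 0 < ω → DoublePowerNLS.IsStandingWaveProfile p q ω (φ ω)) →
      (∀ ω : ℝ, 0 < ω → DifferentiableAt ℝ (DoublePowerNLS.mass φ) ω) ∧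
      (7 / 3 ≤ p → Tendsto (deriv (DoublePowerNLS.mass φ)) (𝓝[>] (0 : ℝ)) atBot) ∧
      (p < 7 / 3 →
        0 < DoublePowerNLS.limitConst p q ∧
        Tendsto (deriv (DoublePowerNLS.mass φ)) (𝓝[>] (0 : ℝ))
          (𝓝 (DoublePowerNLS.limitConst p q *
            (Real.Gamma ((7 - 3 * p) / (2 * (q - p))) /
              Real.Gamma ((7 - 2 * p - q) / (2 * (q - p))))))) := by
  refine ⟨fun ω hω => ?_, fun φ hφ => ?_⟩
  · obtain ⟨e, he, rfl⟩ := exists_frequency_eq hp hpq hω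
    obtain ⟨φ, ψ, h⟩ := exists_isProfileSolution hp hpq he
    exact ⟨φ, h.isStandingWaveProfile⟩
  -- The positivity of `ω` is placed under the existential so that the choice is a function on all
  -- of `ℝ`; its values at `ω ≤ 0` are irrelevant.
  have hex : ∀ ω : ℝ, ∃ e, 0 < ω → 0 < e ∧ frequency p q e = ω := fun ω => by
    by_cases hω : 0 < ω
    · obtain ⟨e, he⟩ := exists_frequency_eq hp hpq hω
      exact ⟨e, fun _ => he⟩
    · exact ⟨0, fun h => absurd h hω⟩
  choose E hE using hex
  have hmass : ∀ ω, 0 < ω → mass φ ω = parametricMass p q (E ω) := fun ω hω => by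
    have h := (hφ ω hω).isProfileSolution
    -- Only the frequency argument is rewritten; the `ω` that indexes the family `φ` must stay.
    nth_rewrite 1 [← (hE ω hω).2] at h
    exact h.half_integral_sq hp hpq (hE ω hω).1
  have hderiv : ∀ ω, 0 < ω → HasDerivAt (mass φ)
      (parametricMassDeriv p q (E ω) / frequencyDeriv p q (E ω)) ω := fun ω hω => by
    refine ((hasDerivAt_parametricMass hp hpq hq (hE ω hω).1).comp ω
      (hasDerivAt_frequency_inverse hp hpq hE hω)).congr_of_eventuallyEq ?_
    filter_upwards [Ioi_mem_nhds hω] with x hx using hmass x hx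
  have hlim := tendsto_frequency_inverse hp hpq hE
  have hev : (fun ω => parametricMassDeriv p q (E ω) / frequencyDeriv p q (E ω)) =ᶠ[𝓝[>] 0]
      deriv (mass φ) := by
    filter_upwards [self_mem_nhdsWithin] with ω hω using (hderiv ω hω).deriv.symm
  refine ⟨fun ω hω => (hderiv ω hω).differentiableAt, fun h7 => ?_, fun h7 =>
    ⟨limitConst_pos hp hpq, ?_⟩⟩
  · exact ((tendsto_parametricMassDeriv_div_atBot hp hpq hq h7).comp hlim).congr' hev
  · exact ((tendsto_parametricMassDeriv_div hp hpq hq h7).comp hlim).congr' hev
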